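/- Let $D$ be a smooth surface and let $S:TD\to TD$ be a smooth endomorphism field whose eigenvalues at every point are real and distinct; write $A>B$ for the eigenvalue functions. For a $1$-form $\phi$ write $\phi=\phi'+\phi''$, where $\phi'$ vanishes on the $B$-eigenlines of $S$ and $\phi''$ vanishes on the $A$-eigenlines, and for a function $f$ put $d'f=(df)'$, $d''f=(df)''$. Assume that $S$ is nondegenerate ($d''A$ and $d'B$ vanish at no point of $D$) and invertible ($A$ and $B$ vanish at no point of $D$). Let $\theta=(\theta_1,\theta_2)$ be the associated coframing $$\theta_1=\frac{A\,d'B}{B(B-A)},\qquad \theta_2=\frac{B\,d''A}{A(A-B)}.$$ Suppose that $\theta$ satisfies, on all of $D$, one of the following three systems: * (Type I) $d\theta_1=\theta_1\wedge\theta_2$, $\ d\theta_2=K_2\,\theta_2\wedge\theta_1$, $\ dK_2=K_{21}\,\theta_1+2(K_2-1)\,\theta_2$ for some functions $K_2$ (smooth) and $K_{21}$ on $D$; * (dual of Type I) $d\theta_1=K_1\,\theta_1\wedge\theta_2$, $\ d\theta_2=\theta_2\wedge\theta_1$, $\ dK_1=2(K_1-1)\,\theta_1+K_{12}\,\theta_2$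 for some functions $K_1$ (smooth) and $K_{12}$ on $D$; * (Type II) $d\theta_1=-2\,\theta_1\wedge\theta_2$, $\ d\theta_2=-2\,\theta_2\wedge\theta_1$. Then every point of $D$ has a connected open neighborhood $N$ on which $S$ is realized by a $3$-parameter family of mutually noncongruent immersions. That is, there are a nonempty connected open set $P\subset\mathbb R^3$ and maps $\mathbf x_t:N\to\mathbb E^3$ $(t\in P)$, depending smoothly on $(t,q)\in P\times N$, such that * each $\mathbf x_t$ is an immersion which, for a suitable smooth unit normal field $\mathbf n_t$, has shape operator $S$, i.e. $-d\mathbf n_t(v)\cdot d\mathbf x_t(w)=d\mathbf x_t(v)\cdot d\mathbf x_t(Sw)=d\mathbf x_t(Sv)\cdot d\mathbf x_t(w)$ for all tangent vectors $v,w$ at the same point of $N$; * for $s\ne t$ in $P$ there is no isometry $F$ of $\mathbb E^3$ with $\mathbf x_t=F\circ\mathbf x_s$ on $N$. -/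

import Mathlib

open scoped Manifold ContDiff InnerProductSpace

noncomputable section

/-- The model plane of a surface. -/
abbrev Plane : Type := EuclideanSpace ℝ (Fin 2)

/-- Euclidean 3-space. -/
abbrev Space : Type := EuclideanSpace ℝ (Fin 3)

section Surface

variable {M : Type*} [TopologicalSpace M] [ChartedSpace Plane M]

variable (M) in
/-- Endomorphisms `S : TM → TM` of the tangent bundle of the surface `M`. -/
abbrev ShapeField : Type _ := ∀ q : M, TangentSpace (𝓡 2) q →L[ℝ] TangentSpace (𝓡 2) q

variable (M) in
/-- Differential 1-forms on the surface `M`. -/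
abbrev OneForm : Type _ := ∀ q : M, TangentSpace (𝓡 2) q →L[ℝ] ℝ

variable (M) in
/-- Bilinear expressions on the tangent spaces of `M` (used for 2-forms). -/
abbrev TwoForm : Type _ := ∀ q : M, TangentSpace (𝓡 2) q → TangentSpace (𝓡 2) q → ℝ

/-- `S` is a smooth section of the bundle `End(TM)`. -/
def ShapeField.IsSmooth [IsManifold (𝓡 2) ∞ M] (S : ShapeField M) : Prop :=
  ContMDiff (𝓡 2) ((𝓡 2).prod 𝓘(ℝ, Plane →L[ℝ] Plane)) ∞
    (fun q => Bundle.TotalSpace.mk' (Plane →L[ℝ] Plane)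
      (E := fun q : M => TangentSpace (𝓡 2) q →L[ℝ] TangentSpace (𝓡 2) q) q (S q))

/-- `A > B` are at every point the two (distinct) eigenvalues of `S`. -/
structure IsPrincipalCurvatures (S : ShapeField M) (A B : M → ℝ) : Prop where
  lt : ∀ q, B q < A q
  eigen_A : ∀ q, Module.End.HasEigenvalue (S q).toLinearMap (A q)
  eigen_B : ∀ q, Module.End.HasEigenvalue (S q).toLinearMap (B q)

/-- Projection of the tangent space onto the `A`-eigenline of `S` along the `B`-eigenline. -/
def projA (S : ShapeField M) (A B : M → ℝ) (q : M) :
    TangentSpace (𝓡 2) q →L[ℝ] TangentSpace (𝓡 2) q :=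
  (A q - B q)⁻¹ • (S q - B q • ContinuousLinearMap.id ℝ (TangentSpace (𝓡 2) q))

/-- Projection of the tangent space onto the `B`-eigenline of `S` along the `A`-eigenline. -/
def projB (S : ShapeField M) (A B : M → ℝ) (q : M) :
    TangentSpace (𝓡 2) q →L[ℝ] TangentSpace (𝓡 2) q :=
  (B q - A q)⁻¹ • (S q - A q • ContinuousLinearMap.id ℝ (TangentSpace (𝓡 2) q))

/-- The differential of a function, as a 1-form. -/
def differential (f : M → ℝ) : OneForm M := fun q => mfderiv (𝓡 2) 𝓘(ℝ, ℝ) f q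

/-- `d' f`: the component of `df` that vanishes on the `B`-eigenline of `S`. -/
def dPrime (S : ShapeField M) (A B f : M → ℝ) : OneForm M :=
  fun q => (differential f q).comp (projA S A B q)

/-- `d'' f`: the component of `df` that vanishes on the `A`-eigenline of `S`. -/
def dDoublePrime (S : ShapeField M) (A B f : M → ℝ) : OneForm M :=
  fun q => (differential f q).comp (projB S A B q)

/-- Nondegeneracy: `d'' A` and `d' B` vanish nowhere
(that `A - B` vanishes nowhere is part of `IsPrincipalCurvatures`). -/
def IsNondegenerate (S : ShapeField M) (A B : M → ℝ) : Prop :=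
  ∀ q, dDoublePrime S A B A q ≠ 0 ∧ dPrime S A B B q ≠ 0

/-- Invertibility: the eigenvalues vanish nowhere. -/
def IsInvertible (A B : M → ℝ) : Prop := ∀ q, A q ≠ 0 ∧ B q ≠ 0

/-- `θ₁ = A d'B / (B (B - A))`. -/
def theta1 (S : ShapeField M) (A B : M → ℝ) : OneForm M :=
  fun q => (A q / (B q * (B q - A q))) • dPrime S A B B q

/-- `θ₂ = B d''A / (A (A - B))`. -/
def theta2 (S : ShapeField M) (A B : M → ℝ) : OneForm M :=
  fun q => (B q / (A q * (A q - B q))) • dDoublePrime S A B A q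

/-- The wedge product of two 1-forms. -/
def wedge (φ ψ : OneForm M) : TwoForm M := fun q v w => φ q v * ψ q w - φ q w * ψ q v

/-- The expression of a 1-form in a chart `e`, that is, its pullback under the inverse of `e`,
as a differential form on the plane (meaningful on `e.target`). -/
def chartForm (e : OpenPartialHomeomorph M Plane) (φ : OneForm M) (y : Plane) :
    Plane [⋀^Fin 1]→L[ℝ] ℝ :=
  ContinuousAlternatingMap.ofSubsingleton ℝ Plane ℝ (0 : Fin 1)
    ((φ (e.symm y)).comp (mfderiv 𝓘(ℝ, Plane) (𝓡 2) e.symm y))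

/-- `dφ = Ω` for a 1-form `φ` and a 2-form `Ω`: in each chart of the surface, the exterior
derivative of the chart expression of `φ` is the chart expression of `Ω`. -/
def HasExtDeriv (φ : OneForm M) (Ω : TwoForm M) : Prop :=
  ∀ e ∈ atlas Plane M, ∀ y ∈ e.target, ∀ v w : Plane,
    extDeriv (chartForm e φ) y ![v, w] =
      Ω (e.symm y) (mfderiv 𝓘(ℝ, Plane) (𝓡 2) e.symm y v)
        (mfderiv 𝓘(ℝ, Plane) (𝓡 2) e.symm y w)

/-- The Type I system for a coframing:
`dθ₁ = θ₁ ∧ θ₂`, `dθ₂ = K₂ θ₂ ∧ θ₁`, `dK₂ = K₂₁ θ₁ + 2 (K₂ - 1) θ₂`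
for some functions `K₂` and `K₂₁`. -/
def TypeISystem (θ₁ θ₂ : OneForm M) : Prop :=
  ∃ K₂ K₂₁ : M → ℝ, ContMDiff (𝓡 2) 𝓘(ℝ, ℝ) ∞ K₂ ∧
    HasExtDeriv θ₁ (wedge θ₁ θ₂) ∧
    HasExtDeriv θ₂ (fun q v w => K₂ q * wedge θ₂ θ₁ q v w) ∧
    ∀ q, differential K₂ q = K₂₁ q • θ₁ q + (2 * (K₂ q - 1)) • θ₂ q

/-- The dual Type I system for a coframing:
`dθ₁ = K₁ θ₁ ∧ θ₂`, `dθ₂ = θ₂ ∧ θ₁`, `dK₁ = 2 (K₁ - 1) θ₁ + K₁₂ θ₂`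
for some functions `K₁` and `K₁₂`. -/
def DualTypeISystem (θ₁ θ₂ : OneForm M) : Prop :=
  ∃ K₁ K₁₂ : M → ℝ, ContMDiff (𝓡 2) 𝓘(ℝ, ℝ) ∞ K₁ ∧
    HasExtDeriv θ₁ (fun q v w => K₁ q * wedge θ₁ θ₂ q v w) ∧
    HasExtDeriv θ₂ (wedge θ₂ θ₁) ∧
    ∀ q, differential K₁ q = (2 * (K₁ q - 1)) • θ₁ q + K₁₂ q • θ₂ q

/-- The Type II system for a coframing: `dθ₁ = -2 θ₁ ∧ θ₂`, `dθ₂ = -2 θ₂ ∧ θ₁`. -/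
def TypeIISystem (θ₁ θ₂ : OneForm M) : Prop :=
  HasExtDeriv θ₁ (fun q v w => -2 * wedge θ₁ θ₂ q v w) ∧
  HasExtDeriv θ₂ (fun q v w => -2 * wedge θ₂ θ₁ q v w)

/-- The differential of a map to Euclidean 3-space, with values in that space. -/
def diffMap (x : M → Space) (q : M) : TangentSpace (𝓡 2) q →L[ℝ] Space :=
  mfderiv (𝓡 2) 𝓘(ℝ, Space) x q

/-- The first fundamental form `I = dx · dx`. -/
def firstForm (x : M → Space) (q : M) (v w : TangentSpace (𝓡 2) q) : ℝ :=
  ⟪diffMap x q v, diffMap x q w⟫_ℝ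

/-- The second fundamental form `II = - dn · dx`. -/
def secondForm (x n : M → Space) (q : M) (v w : TangentSpace (𝓡 2) q) : ℝ :=
  -⟪diffMap n q v, diffMap x q w⟫_ℝ

/-- On the open set `N`, the map `x` is a smooth immersion into Euclidean 3-space and, for some
smooth unit normal field `n` along it, its Weingarten shape operator is `S`:
`II(v, w) = I(v, S w) = I(S v, w)`. -/
def Realizes (S : ShapeField M) (N : Set M) (x : M → Space) : Prop :=
  ContMDiffOn (𝓡 2) 𝓘(ℝ, Space) ∞ x N ∧
  (∀ q ∈ N, Function.Injective (diffMap x q)) ∧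
  ∃ n : M → Space, ContMDiffOn (𝓡 2) 𝓘(ℝ, Space) ∞ n N ∧
    (∀ q ∈ N, ‖n q‖ = 1) ∧
    (∀ q ∈ N, ∀ v, ⟪n q, diffMap x q v⟫_ℝ = 0) ∧
    ∀ q ∈ N, ∀ v w, secondForm x n q v w = firstForm x q v (S q w) ∧
      firstForm x q v (S q w) = firstForm x q (S q v) w

/-- Two maps to Euclidean 3-space are congruent on `N` if they differ there by an isometry of
the space (orientation preserving or not). -/
def CongruentOn (N : Set M) (x y : M → Space) : Prop :=
  ∃ F : Space ≃ᵢ Space, ∀ q ∈ N, y q = F (x q)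

end Surface

end

/-! Look for the third fundamental form of the immersion as `(a θ₁)² + (b θ₂)²`; the first is then
`(a θ₁ / A)² + (b θ₂ / B)²`. The normalization of `θ` turns the Codazzi equations into prescribed
derivatives of `a` along `θ₂` and of `b` along `θ₁`, namely `(K₁ - 1) a` and `(K₂ - 1) b`, and the
Gauss equation says that the third fundamental form has curvature `1`.

In terms of `u = a⁻²` and `v = b⁻²` all this is affine: with `w` the `θ₁`-derivative of `u` and `w'`
the `θ₂`-derivative of `v`, Gauss reads `w + w' = 2 (u + v + 1)`. Imposing `d²u = d²v = 0`
determines `dw`, so `(1, u, v, w)` solves a closed linear total differential system. Each of the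
three systems for `θ` makes it integrable, so the values of `u, v, w` at a point are three free
parameters (`exists_potentialFamily_typeI`, `exists_potentialFamily_typeII`; the dual type follows
by exchanging the two forms).

Given `u, v`, the adapted frame and the position vector `(e₁, e₂, n, x)` solve a second linear
system, flat by `connection_flat`, and integrating it gives the immersions (`exists_adapted_frame`).
Congruent immersions have equal first fundamental forms, hence equal `u` and `v`, hence equal `w`,
hence equal parameters (`exists_plane_family`).

Both integrations use a Frobenius theorem with smooth dependence on parameters
(`exists_fundamental_solution`). It is proved by solving along rays from the base point, where the
equation becomes a Volterra equation in a Banach space of curves; smoothness is that of inversion in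
a Banach algebra. Finally `exists_surface_family` carries the result from a chart to the surface. -/

/-! ### Smooth families of curves as smooth maps into a Banach space; the Volterra operator. -/

noncomputable section ParametricCurves

open Set Filter Topology unitInterval BoundedContinuousFunction

/-- The Banach space of continuous curves in `G` parametrized by the unit interval. -/
def Curve (G : Type) [NormedAddCommGroup G] : Type := I →ᵇ G

namespace Curve

instance (G : Type) [NormedAddCommGroup G] : NormedAddCommGroup (Curve G) :=
  inferInstanceAs (NormedAddCommGroup (I →ᵇ G))

instance (G : Type) [NormedAddCommGroup G] [NormedSpace ℝ G] : NormedSpace ℝ (Curve G) :=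
  inferInstanceAs (NormedSpace ℝ (I →ᵇ G))

instance (G : Type) [NormedAddCommGroup G] [CompleteSpace G] : CompleteSpace (Curve G) :=
  inferInstanceAs (CompleteSpace (I →ᵇ G))

instance (G : Type) [NormedAddCommGroup G] : FunLike (Curve G) I G :=
  inferInstanceAs (FunLike (I →ᵇ G) I G)

variable {G : Type} [NormedAddCommGroup G]

/-- A continuous function on the unit interval as an element of the space of curves. -/
def mk (f : I → G) (hf : Continuous f) : Curve G := mkOfCompact ⟨f, hf⟩

@[simp] lemma mk_apply (f : I → G) (hf : Continuous f) (s : I) : mk f hf s = f s := rfl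

@[simp] lemma add_apply (X Y : Curve G) (s : I) : (X + Y) s = X s + Y s := rfl

@[simp] lemma sub_apply (X Y : Curve G) (s : I) : (X - Y) s = X s - Y s := rfl

@[simp] lemma smul_apply [NormedSpace ℝ G] (c : ℝ) (X : Curve G) (s : I) :
    (c • X) s = c • X s := rfl

@[ext] lemma ext {X Y : Curve G} (h : ∀ s, X s = Y s) : X = Y := DFunLike.ext _ _ h

lemma continuous (X : Curve G) : Continuous X := BoundedContinuousFunction.continuous (α := I) X

attribute [fun_prop] Curve.continuous

lemma norm_apply_le (X : Curve G) (s : I) : ‖X s‖ ≤ ‖X‖ :=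
  BoundedContinuousFunction.norm_coe_le_norm (α := I) X s

lemma norm_le {X : Curve G} {c : ℝ} (hc : 0 ≤ c) : ‖X‖ ≤ c ↔ ∀ s, ‖X s‖ ≤ c :=
  BoundedContinuousFunction.norm_le (α := I) hc

/-- A jointly continuous family of curves is continuous as a map into the space of curves. -/
lemma continuous_of_uncurry {Z : Type} [TopologicalSpace Z] {g : Z → Curve G}
    (hg : Continuous fun q : Z × I => g q.1 q.2) : Continuous g :=
  (ContinuousMap.isometryEquivBoundedOfCompact I G).continuous.comp
    (ContinuousMap.continuous (ContinuousMap.curry ⟨_, hg⟩))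

/-- Evaluation of curves at a point. -/
def eval (G : Type) [NormedAddCommGroup G] [NormedSpace ℝ G] (s : I) : Curve G →L[ℝ] G :=
  LinearMap.mkContinuous
    { toFun := fun X => X s, map_add' := fun _ _ => rfl, map_smul' := fun _ _ => rfl } 1
    (fun X => by rw [one_mul]; exact X.norm_apply_le s)

@[simp] lemma eval_apply [NormedSpace ℝ G] (X : Curve G) (s : I) : eval G s X = X s := rfl

end Curve

/-- Evaluation of a curve of continuous linear maps at a vector, as a continuous linear map into
linear maps with values in curves. -/
def curveFlip (Z G : Type) [NormedAddCommGroup Z] [NormedSpace ℝ Z] [NormedAddCommGroup G]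
    [NormedSpace ℝ G] : Curve (Z →L[ℝ] G) →L[ℝ] Z →L[ℝ] Curve G :=
  LinearMap.mkContinuous₂
    (LinearMap.mk₂ ℝ (fun (φ : Curve (Z →L[ℝ] G)) v => Curve.mk (fun s => φ s v) (by fun_prop))
      (fun _ _ _ => by ext; simp) (fun _ _ _ => by ext; simp)
      (fun _ _ _ => by ext; simp) (fun _ _ _ => by ext; simp)) 1
    (fun φ v => by
      rw [one_mul, Curve.norm_le (by positivity)]
      intro s
      exact (φ s).le_of_opNorm_le (φ.norm_apply_le s) v)

@[simp] lemma curveFlip_apply {Z G : Type} [NormedAddCommGroup Z] [NormedSpace ℝ Z]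
    [NormedAddCommGroup G] [NormedSpace ℝ G] (φ : Curve (Z →L[ℝ] G)) (v : Z) (s : I) :
    curveFlip Z G φ v s = φ s v := rfl

/-- A jointly `C¹` family of curves is differentiable as a map into the space of curves. -/
lemma hasFDerivAt_curve {Z G : Type} [NormedAddCommGroup Z] [NormedSpace ℝ Z]
    [NormedAddCommGroup G] [NormedSpace ℝ G] {F : Z × ℝ → G} {F' : Z × ℝ → Z →L[ℝ] G}
    (hF : ∀ z s, HasFDerivAt (fun z => F (z, s)) (F' (z, s)) z)
    {g : Z → Curve G} (hg : ∀ z s, g z s = F (z, s)) {g' : Z → Curve (Z →L[ℝ] G)}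
    (hg' : ∀ z s, g' z s = F' (z, s)) (hc : Continuous g') (z : Z) :
    HasFDerivAt g (curveFlip Z G (g' z)) z := by
  rw [hasFDerivAt_iff_isLittleO, Asymptotics.isLittleO_iff]
  intro c hc0
  obtain ⟨r, hr, hball⟩ := Metric.continuousAt_iff.1 (hc.continuousAt (x := z)) c hc0
  filter_upwards [Metric.ball_mem_nhds z hr] with y hy
  rw [Curve.norm_le (by positivity)]
  intro s
  -- The mean value inequality is applied for each `s` to `F` minus its linear part at `z`. The
  -- radius `r` comes from continuity of `g'` in the sup norm, so the bound is uniform in `s`.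
  have := (convex_ball z r).norm_image_sub_le_of_norm_hasFDerivWithin_le
    (f := fun z' => F (z', s) - F' (z, s) z') (f' := fun z' => F' (z', s) - F' (z, s)) (C := c)
    (fun x _ => ((hF x s).sub (F' (z, s)).hasFDerivAt).hasFDerivWithinAt)
    (fun x hx => by
      have h1 := (g' x - g' z).norm_apply_le s
      rw [Curve.sub_apply, hg', hg'] at h1
      have h2 := hball hx
      exact h1.trans ((dist_eq_norm (g' x) (g' z)).symm.trans_lt h2).le) (Metric.mem_ball_self hr) hy
  refine le_trans (le_of_eq ?_) this
  simp only [Curve.sub_apply, hg, curveFlip_apply, hg', map_sub]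
  congr 1
  abel

/-- The derivative of the family is again a jointly smooth family of curves, but with values in `Z
→L[ℝ] G`; hence the induction on `n` leaves `G` general. -/
lemma contDiff_curve_nat {Z : Type} [NormedAddCommGroup Z] [NormedSpace ℝ Z] (n : ℕ) :
    ∀ {G : Type} [NormedAddCommGroup G] [NormedSpace ℝ G] {F : Z × ℝ → G}
      (_ : ContDiff ℝ ∞ F) {g : Z → Curve G} (_ : ∀ z s, g z s = F (z, s)), ContDiff ℝ n g := by
  induction n with
  | zero =>
    intro G _ _ F hF g hg
    have hcont : Continuous fun q : Z × I => F (q.1, q.2) := by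
      have := hF.continuous
      fun_prop
    refine contDiff_zero.2 (Curve.continuous_of_uncurry ?_)
    simpa only [hg] using hcont
  | succ n ih =>
    intro G _ _ F hF g hg
    set F' : Z × ℝ → Z →L[ℝ] G :=
      fun q => (fderiv ℝ F q).comp (ContinuousLinearMap.inl ℝ Z ℝ) with hF'
    have hF's : ContDiff ℝ ∞ F' :=
      (hF.fderiv_right (m := ∞) (by simp)).clm_comp contDiff_const
    have hcont : Continuous F' := hF's.continuous
    let g' : Z → Curve (Z →L[ℝ] G) := fun z => Curve.mk (fun s => F' (z, s)) (by fun_prop)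
    have hg's : ContDiff ℝ n g' := ih hF's (fun _ _ => rfl)
    have hflip : ContDiff ℝ n fun z => curveFlip Z G (g' z) :=
      (curveFlip Z G).contDiff.comp hg's
    refine contDiff_succ_iff_hasFDerivAt.2 ⟨_, hflip, fun z => ?_⟩
    refine hasFDerivAt_curve (F := F) (F' := F') (fun z s => ?_) hg (fun _ _ => rfl)
      hg's.continuous z
    have h1 : HasFDerivAt F (fderiv ℝ F (z, s)) (z, s) :=
      (hF.differentiable (by simp) _).hasFDerivAt
    exact h1.comp z (hasFDerivAt_prodMk_left z s)

/-- A jointly smooth family of curves is smooth as a map into the space of curves. -/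
theorem contDiff_curve {Z G : Type} [NormedAddCommGroup Z] [NormedSpace ℝ Z]
    [NormedAddCommGroup G] [NormedSpace ℝ G] {F : Z × ℝ → G} (hF : ContDiff ℝ ∞ F)
    {g : Z → Curve G} (hg : ∀ z s, g z s = F (z, s)) : ContDiff ℝ ∞ g :=
  contDiff_infty.2 fun n => contDiff_curve_nat n hF hg

/-- The Volterra operator on curves. -/
def volterra (G : Type) [NormedAddCommGroup G] [NormedSpace ℝ G] : Curve G →L[ℝ] Curve G :=
  LinearMap.mkContinuous
    { toFun := fun Y => Curve.mk (fun s => ∫ r in (0 : ℝ)..s, Y (projIcc 0 1 zero_le_one r)) (by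
        have h : Continuous fun x : ℝ => ∫ r in (0 : ℝ)..x, Y (projIcc 0 1 zero_le_one r) :=
          intervalIntegral.continuous_primitive
            (fun a b => Continuous.intervalIntegrable (by fun_prop) _ _) 0
        fun_prop)
      map_add' := fun X Y => by
        ext s
        exact intervalIntegral.integral_add (Continuous.intervalIntegrable (by fun_prop) _ _)
          (Continuous.intervalIntegrable (by fun_prop) _ _)
      map_smul' := fun c Y => by
        ext s
        exact intervalIntegral.integral_smul _ _ } 1
    (fun Y => by
      rw [one_mul, Curve.norm_le (by positivity)]
      intro s
      refine (intervalIntegral.norm_integral_le_of_norm_le_const (C := ‖Y‖)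
        fun r _ => Y.norm_apply_le _).trans ?_
      rw [sub_zero, abs_of_nonneg s.2.1]
      exact mul_le_of_le_one_right (norm_nonneg _) s.2.2)

lemma volterra_apply {G : Type} [NormedAddCommGroup G] [NormedSpace ℝ G] (Y : Curve G) (s : I) :
    volterra G Y s = ∫ r in (0 : ℝ)..s, Y (projIcc 0 1 zero_le_one r) := rfl

/-- A `C¹` curve starting at `0` is the primitive of its velocity. -/
lemma eq_volterra_of_hasDerivAt {G : Type} [NormedAddCommGroup G] [NormedSpace ℝ G]
    [CompleteSpace G] {f f' : ℝ → G} (hf : ∀ s ∈ Icc (0 : ℝ) 1, HasDerivAt f (f' s) s)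
    (h0 : f 0 = 0) {N Y : Curve G} (hN : ∀ s : I, N s = f s) (hY : ∀ s : I, Y s = f' s) :
    N = volterra G Y := by
  ext s
  have hsub : ∀ r ∈ uIcc (0 : ℝ) s, r ∈ Icc (0 : ℝ) 1 := fun r hr => by
    rw [uIcc_of_le s.2.1] at hr
    exact ⟨hr.1, hr.2.trans s.2.2⟩
  have hproj : ∀ r ∈ uIcc (0 : ℝ) s, Y (projIcc 0 1 zero_le_one r) = f' r := fun r hr => by
    rw [hY, projIcc_of_mem _ (hsub r hr)]
  rw [volterra_apply, hN, intervalIntegral.integral_congr hproj,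
    intervalIntegral.integral_eq_sub_of_hasDerivAt (fun r hr => hf r (hsub r hr)), h0, sub_zero]
  -- `f'` is not assumed continuous; its integrability comes from its agreement with the continuous
  -- curve `Y`.
  refine (Continuous.intervalIntegrable (u := fun r => Y (projIcc 0 1 zero_le_one r))
    (by fun_prop) _ _).congr ?_
  intro r hr
  exact hproj r (uIoc_subset_uIcc hr)

end ParametricCurves

/-! ### Frobenius' theorem for linear systems with parameters. -/

noncomputable section Frobenius

open Set Filter Topology unitInterval Metric

/-- Pointwise multiplication of curves in an algebra. -/
def curveMul (R : Type) [NormedRing R] [NormedAlgebra ℝ R] :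
    Curve R →L[ℝ] Curve R →L[ℝ] Curve R :=
  LinearMap.mkContinuous₂
    (LinearMap.mk₂ ℝ (fun X Y => Curve.mk (fun s => X s * Y s) (by fun_prop))
      (fun _ _ _ => by ext; simp [add_mul]) (fun _ _ _ => by ext; simp)
      (fun _ _ _ => by ext; simp [mul_add]) (fun _ _ _ => by ext; simp)) 1
    (fun X Y => by
      rw [one_mul, Curve.norm_le (by positivity)]
      intro s
      exact (norm_mul_le _ _).trans
        (mul_le_mul (X.norm_apply_le s) (Y.norm_apply_le s) (norm_nonneg _) (norm_nonneg _)))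

@[simp] lemma curveMul_apply {R : Type} [NormedRing R] [NormedAlgebra ℝ R] (X Y : Curve R)
    (s : I) : curveMul R X Y s = X s * Y s := rfl

/-- The integrability condition of the total differential equation `dY = M Y`, in which the
parameter in `T` is kept fixed. -/
def IsIntegrableAt {T Q R : Type} [NormedAddCommGroup T] [NormedSpace ℝ T]
    [NormedAddCommGroup Q] [NormedSpace ℝ Q] [NormedRing R] [NormedAlgebra ℝ R]
    (M : T × Q → Q →L[ℝ] R) (z : T × Q) : Prop :=
  ∀ v w : Q, fderiv ℝ M z (0, w) v + M z v * M z w = fderiv ℝ M z (0, v) w + M z w * M z v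

variable {T Q R : Type} [NormedAddCommGroup T] [NormedSpace ℝ T]
  [NormedAddCommGroup Q] [NormedSpace ℝ Q] [NormedRing R] [NormedAlgebra ℝ R]

/-- Along the ray from `p` to `q`, the candidate for the derivative of the radial solution
solves the linearized radial equation. -/
lemma radial_volterra [CompleteSpace R] {M : T × Q → Q →L[ℝ] R} (hM : ContDiff ℝ ∞ M)
    {t : T} {p q : Q} (hint : ∀ s ∈ Icc (0 : ℝ) 1, IsIntegrableAt M (t, p + s • (q - p)))
    {one l l' g N : Curve R} (v : Q) (hone : ∀ s, one s = 1)
    (hl : ∀ s : I, l s = M (t, p + (s : ℝ) • (q - p)) (q - p))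
    (hl' : ∀ s : I, l' s = (s : ℝ) • fderiv ℝ M (t, p + (s : ℝ) • (q - p)) (0, v) (q - p) +
      M (t, p + (s : ℝ) • (q - p)) v)
    (hg : g = one + volterra R (curveMul R l g))
    (hN : ∀ s : I, N s = (s : ℝ) • (M (t, p + (s : ℝ) • (q - p)) v * g s)) :
    N = volterra R (curveMul R l' g + curveMul R l N) := by
  -- An extension of `g` to the whole line, so that it can be differentiated at the endpoints too.
  let Γ : ℝ → R := fun s => 1 + ∫ r in (0 : ℝ)..s, curveMul R l g (projIcc 0 1 zero_le_one r)
  have hΓg : ∀ s : I, Γ s = g s := fun s => by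
    have h := congrArg (fun X : Curve R => X s) hg
    simp only [Curve.add_apply, hone, volterra_apply] at h
    exact h.symm
  have hΓ' : ∀ s : ℝ, HasDerivAt Γ (curveMul R l g (projIcc 0 1 zero_le_one s)) s := fun s => by
    refine HasDerivAt.const_add _ ?_
    have hc : Continuous fun r : ℝ => curveMul R l g (projIcc 0 1 zero_le_one r) := by fun_prop
    exact intervalIntegral.integral_hasDerivAt_right (hc.intervalIntegrable _ _)
      (hc.stronglyMeasurableAtFilter _ _) hc.continuousAt
  let γ : ℝ → T × Q := fun s => (t, p + s • (q - p))
  have hγ : ∀ s, HasDerivAt γ (0, q - p) s := fun s => by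
    have h1 : HasDerivAt (fun s : ℝ => p + s • (q - p)) ((1 : ℝ) • (q - p)) s :=
      ((hasDerivAt_id s).smul_const (q - p)).const_add p
    rw [one_smul] at h1
    exact (hasDerivAt_const s t).prodMk h1
  have hMγ : ∀ s, HasDerivAt (fun s => M (γ s) v) (fderiv ℝ M (γ s) (0, q - p) v) s := fun s => by
    have h1 : HasFDerivAt M (fderiv ℝ M (γ s)) (γ s) :=
      (hM.differentiable (by simp) _).hasFDerivAt
    have h2 := h1.comp_hasDerivAt s (hγ s)
    exact ((ContinuousLinearMap.apply ℝ R v).hasFDerivAt.comp_hasDerivAt s h2)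
  have hder : ∀ s, HasDerivAt (fun s : ℝ => s • (M (γ s) v * Γ s))
      (s • (fderiv ℝ M (γ s) (0, q - p) v * Γ s +
        M (γ s) v * curveMul R l g (projIcc 0 1 zero_le_one s)) +
        (1 : ℝ) • (M (γ s) v * Γ s)) s := fun s =>
    (hasDerivAt_id s).smul ((hMγ s).mul (hΓ' s))
  refine eq_volterra_of_hasDerivAt (fun s _ => hder s) (by simp) (fun s => ?_) (fun s => ?_)
  · rw [hN, hΓg]
  · have hi := hint s s.2 v (q - p)
    rw [projIcc_val, hΓg, Curve.add_apply, curveMul_apply, curveMul_apply, curveMul_apply, hl',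
      hl, hN]
    -- Integrability in the pair `v`, `q - p` exchanges the derivative of `M v` along the ray for
    -- the derivative of `M (q - p)` in the direction `v`, which is the one occurring in `l'`.
    have e : fderiv ℝ M (γ s) (0, q - p) v + M (γ s) v * M (γ s) (q - p) =
      fderiv ℝ M (γ s) (0, v) (q - p) + M (γ s) (q - p) * M (γ s) v := hi
    change ((s : ℝ) • fderiv ℝ M (γ s) (0, v) (q - p) + M (γ s) v) * g s +
      M (γ s) (q - p) * ((s : ℝ) • (M (γ s) v * g s)) = (s : ℝ) •
      (fderiv ℝ M (γ s) (0, q - p) v * g s + M (γ s) v * (M (γ s) (q - p) * g s)) +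
      (1 : ℝ) • (M (γ s) v * g s)
    rw [← mul_assoc (M (γ s) v), ← add_mul, e, one_smul]
    simp only [add_mul, smul_mul_assoc, mul_smul_comm, smul_add, mul_assoc]
    abel

/-- Frobenius' theorem for linear total differential equations `dY = M Y` depending smoothly on
parameters. -/
theorem exists_fundamental_solution_of_contDiff [CompleteSpace R] {M : T × Q → Q →L[ℝ] R}
    (hM : ContDiff ℝ ∞ M) {t₀ : T} {p : Q} (hint : ∀ᶠ z in 𝓝 (t₀, p), IsIntegrableAt M z) :
    ∃ r > 0, ∃ Φ : T × Q → R, ContDiffOn ℝ ∞ Φ (ball t₀ r ×ˢ ball p r) ∧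
      (∀ t, Φ (t, p) = 1) ∧
      ∀ t ∈ ball t₀ r, ∀ q ∈ ball p r, HasFDerivAt (fun q => Φ (t, q))
        (((ContinuousLinearMap.mul ℝ R).flip (Φ (t, q))).comp (M (t, q))) q := by
  let L : (T × Q) × ℝ → R := fun x => M (x.1.1, p + x.2 • (x.1.2 - p)) (x.1.2 - p)
  have hL : ContDiff ℝ ∞ L := by
    have h1 : ContDiff ℝ ∞ fun x : (T × Q) × ℝ => (x.1.1, p + x.2 • (x.1.2 - p)) := by fun_prop
    exact (hM.comp h1).clm_apply (by fun_prop)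
  let l : T × Q → Curve R := fun z => Curve.mk (fun s => L (z, s)) (by
    have := hL.continuous
    fun_prop)
  have hl : ContDiff ℝ ∞ l := contDiff_curve hL fun _ _ => rfl
  let V : Curve R →L[ℝ] Curve R →L[ℝ] Curve R :=
    ((ContinuousLinearMap.compL ℝ _ _ _) (volterra R)).comp (curveMul R)
  have hV : ∀ X Y, V X Y = volterra R (curveMul R X Y) := fun _ _ => rfl
  -- The radial equation `g' = l g`, `g 0 = 1` is `A z g = one`. At `q = p` the ray is constant, so
  -- `l = 0` and `A = 1`; hence `A` is invertible near `(t₀, p)`, and its inverse depends smoothly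
  -- on `z`.
  let A : T × Q → (Curve R →L[ℝ] Curve R) := fun z => 1 - V (l z)
  have hA : ContDiff ℝ ∞ A := contDiff_const.sub (V.contDiff.comp hl)
  let one : Curve R := Curve.mk (fun _ => 1) continuous_const
  let G : T × Q → Curve R := fun z => Ring.inverse (A z) one
  let W : Set (T × Q) := {z | IsUnit (A z)}
  have hW : IsOpen W := Units.isOpen.preimage hA.continuous
  have hlp : ∀ t, l (t, p) = 0 := fun t => by
    ext s
    change M _ (p - p) = 0
    simp
  have hAp : ∀ t, A (t, p) = 1 := fun t => by simp only [A, hlp, map_zero, sub_zero]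
  have hGd : ∀ z ∈ W, ContDiffAt ℝ ∞ G z := fun z hz => by
    obtain ⟨x, hx⟩ := (hz : IsUnit (A z))
    have h1 : ContDiffAt ℝ ∞ Ring.inverse (A z) := by rw [← hx]; exact contDiffAt_ringInverse ℝ x
    exact (ContinuousLinearMap.apply ℝ (Curve R) one).contDiff.contDiffAt.comp z
      (h1.comp z hA.contDiffAt)
  have hGeq : ∀ z ∈ W, G z = one + V (l z) (G z) := fun z hz => by
    have h1 : (A z * Ring.inverse (A z)) one = one := by rw [Ring.mul_inverse_cancel _ hz]; rfl
    have h2 : G z - V (l z) (G z) = one := h1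
    rw [← h2]
    abel
  have hinj : ∀ z ∈ W, ∀ X Y Z : Curve R, X = Z + V (l z) X → Y = Z + V (l z) Y → X = Y :=
    fun z hz X Y Z hX hY => by
      have h0 : A z X = A z Y := by
        change X - V (l z) X = Y - V (l z) Y
        rw [sub_eq_of_eq_add hX, sub_eq_of_eq_add hY]
      have h1 : ∀ X, Ring.inverse (A z) (A z X) = X := fun X => by
        change (Ring.inverse (A z) * A z) X = X
        rw [Ring.inverse_mul_cancel _ hz]
        rfl
      rw [← h1 X, h0, h1]
  have hpW : (t₀, p) ∈ W := by
    change IsUnit _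
    rw [hAp]
    exact isUnit_one
  obtain ⟨r, hr, hball⟩ := Metric.mem_nhds_iff.1 (inter_mem (hW.mem_nhds hpW) hint)
  rw [← ball_prod_same] at hball
  refine ⟨r, hr, fun z => G z 1, ?_, fun t => ?_, fun t ht q hq => ?_⟩
  · intro z hz
    exact ((Curve.eval R 1).contDiff.contDiffAt.comp z
      (hGd z (hball hz).1)).contDiffWithinAt
  · change Ring.inverse (A (t, p)) one 1 = 1
    rw [hAp, Ring.inverse_one]
    rfl
  · have hz : (t, q) ∈ W := (hball (mk_mem_prod ht hq)).1
    have hGf : HasFDerivAt (fun q => G (t, q))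
        ((fderiv ℝ G (t, q)).comp (ContinuousLinearMap.inr ℝ T Q)) q :=
      ((hGd _ hz).differentiableAt (by simp)).hasFDerivAt.comp q (hasFDerivAt_prodMk_right t q)
    have hlf : HasFDerivAt (fun q => l (t, q))
        ((fderiv ℝ l (t, q)).comp (ContinuousLinearMap.inr ℝ T Q)) q :=
      ((hl.differentiable (by simp)) _).hasFDerivAt.comp q (hasFDerivAt_prodMk_right t q)
    set D := (fderiv ℝ G (t, q)).comp (ContinuousLinearMap.inr ℝ T Q)
    set l' := (fderiv ℝ l (t, q)).comp (ContinuousLinearMap.inr ℝ T Q)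
    have hray : ∀ s ∈ Icc (0 : ℝ) 1, IsIntegrableAt M (t, p + s • (q - p)) := fun s hs => by
      refine (hball (mk_mem_prod ht ?_)).2
      exact (convex_ball p r).add_smul_sub_mem (mem_ball_self hr) hq hs
    -- Both sides solve the same linearized Volterra equation: the left by differentiating the
    -- equation of `G` in `q`, the right by `radial_volterra`. Uniqueness is `hinj`. At `s = 1` this
    -- says `dΦ = M Φ`.
    have key : ∀ v, D v = Curve.mk (fun s => (s : ℝ) • (M (t, p + (s : ℝ) • (q - p)) v *
        G (t, q) s)) (by have := hM.continuous; fun_prop) := fun v => by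
      refine hinj _ hz _ _ (V (l' v) (G (t, q))) ?_ ?_
      · have h1 : HasFDerivAt (fun q => one + V (l (t, q)) (G (t, q)))
            (V.precompR Q (l (t, q)) D + V.precompL Q l' (G (t, q))) q :=
          (V.hasFDerivAt_of_bilinear hlf hGf).const_add one
        have h2 : (fun q => one + V (l (t, q)) (G (t, q))) =ᶠ[𝓝 q] fun q => G (t, q) := by
          have : ∀ᶠ q' in 𝓝 q, (t, q') ∈ W :=
            (Continuous.prodMk_right t).continuousAt.eventually (hW.mem_nhds hz)
          filter_upwards [this] with q' hq'
          exact (hGeq _ hq').symm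
        have h3 := (h1.congr_of_eventuallyEq h2.symm).unique hGf
        have h4 : V (l (t, q)) (D v) + V (l' v) (G (t, q)) = D v := congrArg (fun f => f v) h3
        rw [add_comm, h4]
      · rw [hV, hV, ← map_add]
        refine radial_volterra hM hray v (one := one) (fun _ => rfl) (l := l (t, q))
          (fun _ => rfl) (fun s => ?_) (hGeq _ hz) (fun _ => rfl)
        have h1 : HasFDerivAt (fun q => l (t, q) s) ((Curve.eval R s).comp l') q :=
          (Curve.eval R s).hasFDerivAt.comp q hlf
        have h2 : HasFDerivAt (fun q => (t, p + (s : ℝ) • (q - p)))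
            ((0 : Q →L[ℝ] T).prod ((s : ℝ) • ContinuousLinearMap.id ℝ Q)) q :=
          (hasFDerivAt_const t q).prodMk ((((hasFDerivAt_id q).sub_const p).const_smul
            (s : ℝ)).const_add p)
        have h3 : HasFDerivAt M (fderiv ℝ M (t, p + (s : ℝ) • (q - p)))
            (t, p + (s : ℝ) • (q - p)) := (hM.differentiable (by simp) _).hasFDerivAt
        have h4 := (h3.comp q h2).clm_apply ((hasFDerivAt_id q).sub_const p)
        have h5 := congrArg (fun f => f v) (h1.unique h4)
        simp only [_root_.add_apply, ContinuousLinearMap.comp_apply,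
          ContinuousLinearMap.flip_apply, ContinuousLinearMap.prod_apply,
          _root_.zero_apply, _root_.smul_apply,
          ContinuousLinearMap.id_apply, Curve.eval_apply, Function.comp_apply, id] at h5
        rw [h5, add_comm, ← _root_.smul_apply, ← map_smul, Prod.smul_mk, smul_zero]
    have h1 : HasFDerivAt (fun q => G (t, q) 1) ((Curve.eval R 1).comp D) q :=
      (Curve.eval R 1).hasFDerivAt.comp q hGf
    refine h1.congr_fderiv ?_
    ext v
    simp [key]

/-- **Frobenius' theorem** for linear total differential equations `dY = M Y` depending smoothly
on parameters, local version. -/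
theorem exists_fundamental_solution [CompleteSpace R] [FiniteDimensional ℝ T]
    [FiniteDimensional ℝ Q] {M : T × Q → Q →L[ℝ] R} {t₀ : T} {p : Q} {O : Set (T × Q)}
    (hO : O ∈ 𝓝 (t₀, p)) (hM : ContDiffOn ℝ ∞ M O) (hint : ∀ z ∈ O, IsIntegrableAt M z) :
    ∃ r > 0, ball t₀ r ×ˢ ball p r ⊆ O ∧
      ∃ Φ : T × Q → R, ContDiffOn ℝ ∞ Φ (ball t₀ r ×ˢ ball p r) ∧
      (∀ t, Φ (t, p) = 1) ∧
      ∀ t ∈ ball t₀ r, ∀ q ∈ ball p r, HasFDerivAt (fun q => Φ (t, q))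
        (((ContinuousLinearMap.mul ℝ R).flip (Φ (t, q))).comp (M (t, q))) q := by
  -- A cutoff extends the coefficients smoothly to the whole space. Integrability survives only near
  -- `(t₀, p)`, where `χ = 1`, and no more is needed.
  obtain ⟨χ, hχ, hχs, hχ1⟩ : ∃ χ : T × Q → ℝ, ContDiff ℝ ∞ χ ∧ tsupport χ ⊆ interior O ∧
      ∀ᶠ z in 𝓝 (t₀, p), χ z = 1 := by
    obtain ⟨ε, hε, hb⟩ := Metric.mem_nhds_iff.1 (interior_mem_nhds.2 hO)
    let f : ContDiffBump ((t₀, p) : T × Q) := ⟨ε / 4, ε / 2, by linarith, by linarith⟩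
    refine ⟨f, f.contDiff, ?_, f.eventuallyEq_one⟩
    rw [f.tsupport_eq]
    exact (closedBall_subset_ball (by change ε / 2 < ε; linarith)).trans hb
  have hM' : ContDiff ℝ ∞ fun z => χ z • M z := contDiff_iff_contDiffAt.2 fun z => by
    by_cases hz : z ∈ tsupport χ
    · exact hχ.contDiffAt.smul (hM.contDiffAt (mem_interior_iff_mem_nhds.1 (hχs hz)))
    · refine contDiffAt_const (c := (0 : Q →L[ℝ] R)) |>.congr_of_eventuallyEq ?_
      filter_upwards [(isClosed_tsupport χ).isOpen_compl.mem_nhds hz] with y hy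
      rw [image_eq_zero_of_notMem_tsupport hy]
      exact zero_smul ℝ (M y)
  have hint' : ∀ᶠ z in 𝓝 (t₀, p), IsIntegrableAt (fun z => χ z • M z) z := by
    filter_upwards [hO, hχ1.eventually_nhds] with z hz h1
    have he : (fun z => χ z • M z) =ᶠ[𝓝 z] M := by
      filter_upwards [h1] with y hy
      rw [hy, one_smul]
    intro v w
    rw [he.fderiv_eq, he.self_of_nhds]
    exact hint z hz v w
  obtain ⟨r, hr, Φ, hΦ, hΦ1, hΦ'⟩ := exists_fundamental_solution_of_contDiff hM' hint'
  obtain ⟨ε, hε, hb⟩ := Metric.mem_nhds_iff.1 (inter_mem hO hχ1)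
  rw [← ball_prod_same] at hb
  have h1 : ball t₀ (min r ε) ⊆ ball t₀ r := ball_subset_ball (min_le_left _ _)
  have h2 : ball p (min r ε) ⊆ ball p r := ball_subset_ball (min_le_left _ _)
  have hb' : ball t₀ (min r ε) ×ˢ ball p (min r ε) ⊆ O ∩ {z | χ z = 1} :=
    (Set.prod_mono (ball_subset_ball (min_le_right _ _)) (ball_subset_ball (min_le_right _ _))).trans hb
  refine ⟨min r ε, lt_min hr hε, fun z hz => (hb' hz).1, Φ, hΦ.mono (Set.prod_mono h1 h2), hΦ1,
    fun t ht q hq => ?_⟩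
  have h3 := hΦ' t (h1 ht) q (h2 hq)
  have h4 : χ (t, q) = 1 := (hb' (mk_mem_prod ht hq)).2
  simpa only [h4, one_smul] using h3

end Frobenius

/-! ### Derivatives and linear systems expressed in a coframing of the plane. -/

noncomputable section CoframeSystems

open Set Filter Topology Metric

/-- The function `f` on the plane has the differential `a θ + b φ` at `q`. -/
def HasFrameDeriv (θ φ : Plane →L[ℝ] ℝ) (f : Plane → ℝ) (a b : ℝ) (q : Plane) : Prop :=
  HasFDerivAt f (a • θ + b • φ) q

namespace HasFrameDeriv

variable {θ φ : Plane →L[ℝ] ℝ} {f g : Plane → ℝ} {a b a' b' : ℝ} {q : Plane}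

lemma congr_coeff (h : HasFrameDeriv θ φ f a b q) (ha : a = a') (hb : b = b') :
    HasFrameDeriv θ φ f a' b' q := ha ▸ hb ▸ h

lemma swap (h : HasFrameDeriv θ φ f a b q) : HasFrameDeriv φ θ f b a q := by
  unfold HasFrameDeriv at *
  rwa [add_comm]

lemma const (c : ℝ) : HasFrameDeriv θ φ (fun _ => c) 0 0 q := by
  simpa [HasFrameDeriv] using hasFDerivAt_const c q

lemma add (hf : HasFrameDeriv θ φ f a b q) (hg : HasFrameDeriv θ φ g a' b' q) :
    HasFrameDeriv θ φ (fun x => f x + g x) (a + a') (b + b') q :=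
  (HasFDerivAt.add hf hg).congr_fderiv (by ext v; simp; ring)

lemma neg (hf : HasFrameDeriv θ φ f a b q) :
    HasFrameDeriv θ φ (fun x => -f x) (-a) (-b) q :=
  (HasFDerivAt.neg hf).congr_fderiv (by ext v; simp; ring)

lemma mul (hf : HasFrameDeriv θ φ f a b q) (hg : HasFrameDeriv θ φ g a' b' q) :
    HasFrameDeriv θ φ (fun x => f x * g x) (a * g q + f q * a') (b * g q + f q * b') q :=
  (HasFDerivAt.mul hf hg).congr_fderiv (by ext v; simp; ring)

lemma comp_deriv {F : ℝ → ℝ} {c : ℝ} (hF : HasDerivAt F c (f q))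
    (hf : HasFrameDeriv θ φ f a b q) : HasFrameDeriv θ φ (fun x => F (f x)) (c * a) (c * b) q :=
  (hF.comp_hasFDerivAt q hf).congr_fderiv (by ext v; simp; ring)

lemma inv (hf : HasFrameDeriv θ φ f a b q) (h0 : f q ≠ 0) :
    HasFrameDeriv θ φ (fun x => (f x)⁻¹) (-a / f q ^ 2) (-b / f q ^ 2) q :=
  (comp_deriv (hasDerivAt_inv h0) hf).congr_coeff (by ring) (by ring)

lemma div (hf : HasFrameDeriv θ φ f a b q) (hg : HasFrameDeriv θ φ g a' b' q) (h0 : g q ≠ 0) :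
    HasFrameDeriv θ φ (fun x => f x / g x) ((a * g q - f q * a') / g q ^ 2)
      ((b * g q - f q * b') / g q ^ 2) q := by
  simp only [div_eq_mul_inv]
  refine (hf.mul (hg.inv h0)).congr_coeff ?_ ?_ <;> field_simp <;> ring

lemma sum {ι : Type} {s : Finset ι} {f : ι → Plane → ℝ} {a b : ι → ℝ}
    (h : ∀ i ∈ s, HasFrameDeriv θ φ (f i) (a i) (b i) q) :
    HasFrameDeriv θ φ (fun x => ∑ i ∈ s, f i x) (∑ i ∈ s, a i) (∑ i ∈ s, b i) q :=
  (HasFDerivAt.fun_sum h).congr_fderiv (by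
    simp only [Finset.sum_smul, Finset.sum_add_distrib])

end HasFrameDeriv

/-- A smooth coframing `(θ₁, θ₂)` of an open set in the plane with structure equations
`dθ₁ = K₁ θ₁ ∧ θ₂`, `dθ₂ = K₂ θ₂ ∧ θ₁`. -/
structure IsCoframing (U : Set Plane) (θ₁ θ₂ : Plane → Plane →L[ℝ] ℝ) (K₁ K₂ : Plane → ℝ) :
    Prop where
  isOpen : IsOpen U
  smooth₁ : ContDiffOn ℝ ∞ θ₁ U
  smooth₂ : ContDiffOn ℝ ∞ θ₂ U
  injective : ∀ q ∈ U, ∀ v, θ₁ q v = 0 → θ₂ q v = 0 → v = 0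
  ext₁ : ∀ q ∈ U, ∀ v w, fderiv ℝ θ₁ q v w - fderiv ℝ θ₁ q w v =
    K₁ q * (θ₁ q v * θ₂ q w - θ₁ q w * θ₂ q v)
  ext₂ : ∀ q ∈ U, ∀ v w, fderiv ℝ θ₂ q v w - fderiv ℝ θ₂ q w v =
    K₂ q * (θ₂ q v * θ₁ q w - θ₂ q w * θ₁ q v)

lemma IsCoframing.swap {U : Set Plane} {θ₁ θ₂ : Plane → Plane →L[ℝ] ℝ} {K₁ K₂ : Plane → ℝ}
    (h : IsCoframing U θ₁ θ₂ K₁ K₂) : IsCoframing U θ₂ θ₁ K₂ K₁ :=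
  ⟨h.isOpen, h.smooth₂, h.smooth₁, fun q hq v h1 h2 => h.injective q hq v h2 h1, h.ext₂, h.ext₁⟩

section Matrix

/-- The space of parameters. -/
abbrev Param : Type := EuclideanSpace ℝ (Fin 3)

/-- The Banach algebra of square matrices, acting on column vectors. -/
abbrev MatrixAlgebra (n : ℕ) : Type := (Fin n → ℝ) →L[ℝ] (Fin n → ℝ)

namespace MatrixAlgebra

variable {n : ℕ}

/-- A matrix as an element of the Banach algebra of matrices. -/
def of (A : Matrix (Fin n) (Fin n) ℝ) : MatrixAlgebra n := A.mulVecLin.toContinuousLinearMap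

lemma of_apply (A : Matrix (Fin n) (Fin n) ℝ) (v : Fin n → ℝ) : of A v = A.mulVec v := rfl

lemma of_add (A B : Matrix (Fin n) (Fin n) ℝ) : of (A + B) = of A + of B := by
  refine ContinuousLinearMap.ext fun v => ?_
  simp [of_apply, Matrix.add_mulVec]

lemma of_sub (A B : Matrix (Fin n) (Fin n) ℝ) : of (A - B) = of A - of B := by
  refine ContinuousLinearMap.ext fun v => ?_
  simp [of_apply, Matrix.sub_mulVec]

lemma of_mul (A B : Matrix (Fin n) (Fin n) ℝ) : of (A * B) = of A * of B := by
  refine ContinuousLinearMap.ext fun v => ?_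
  simp [of_apply, Matrix.mulVec_mulVec]

lemma of_smul (c : ℝ) (A : Matrix (Fin n) (Fin n) ℝ) : of (c • A) = c • of A := by
  refine ContinuousLinearMap.ext fun v => ?_
  simp [of_apply, Matrix.smul_mulVec]

lemma of_sum {ι : Type} (s : Finset ι) (f : ι → Matrix (Fin n) (Fin n) ℝ) :
    of (∑ i ∈ s, f i) = ∑ i ∈ s, of (f i) := by
  refine ContinuousLinearMap.ext fun v => ?_
  simp [of_apply, Matrix.sum_mulVec]

/-- The matrix of an element of the Banach algebra of matrices. -/
def toMatrix (X : MatrixAlgebra n) : Matrix (Fin n) (Fin n) ℝ :=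
  Matrix.of fun i j => X (Pi.single j 1) i

lemma toMatrix_one : toMatrix (1 : MatrixAlgebra n) = 1 := by
  ext i j
  simp [toMatrix, Matrix.one_apply, Pi.single_apply]

/-- Entries of matrices, as continuous linear functionals. -/
def entry (i j : Fin n) : MatrixAlgebra n →L[ℝ] ℝ :=
  (ContinuousLinearMap.proj (R := ℝ) (φ := fun _ : Fin n => ℝ) i).comp
    (ContinuousLinearMap.apply ℝ (Fin n → ℝ) (Pi.single j 1))

lemma entry_of (i j : Fin n) (A : Matrix (Fin n) (Fin n) ℝ) : entry i j (of A) = A i j := by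
  simp [entry, of_apply]

lemma entry_of_mul (i j : Fin n) (A : Matrix (Fin n) (Fin n) ℝ) (X : MatrixAlgebra n) :
    entry i j (of A * X) = (A * toMatrix X) i j := rfl

lemma ext_entry {X Y : MatrixAlgebra n} (h : ∀ i j, entry i j X = entry i j Y) : X = Y :=
  ContinuousLinearMap.coe_injective (LinearMap.pi_ext' fun j => LinearMap.ext_ring <|
    funext fun i => h i j)

lemma contDiffOn_of {O : Set (Param × Plane)} {m : Param × Plane → Matrix (Fin n) (Fin n) ℝ}
    (hm : ∀ i j, ContDiffOn ℝ ∞ (fun z => m z i j) O) : ContDiffOn ℝ ∞ (fun z => of (m z)) O := by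
  have h : ∀ z, of (m z) = ∑ i, ∑ j, m z i j • of (Matrix.single i j (1 : ℝ)) := fun z => by
    conv_lhs => rw [Matrix.matrix_eq_sum_single (m z)]
    simp only [← of_smul, ← of_sum, Matrix.smul_single, smul_eq_mul, mul_one]
  simp only [h]
  exact ContDiffOn.sum fun i _ => ContDiffOn.sum fun j _ => (hm i j).smul contDiffOn_const

/-- The derivative of a matrix function in the plane directions, from those of its entries. -/
lemma fderiv_of {m : Param × Plane → Matrix (Fin n) (Fin n) ℝ}
    {z : Param × Plane} (hm : DifferentiableAt ℝ (fun z => of (m z)) z) {θ φ : Plane →L[ℝ] ℝ}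
    {a b : Matrix (Fin n) (Fin n) ℝ}
    (h : ∀ i j, HasFrameDeriv θ φ (fun q => m (z.1, q) i j) (a i j) (b i j) z.2) (v : Plane) :
    fderiv ℝ (fun z => of (m z)) z (0, v) = θ v • of a + φ v • of b := by
  refine ext_entry fun i j => ?_
  have h1 : HasFDerivAt (fun q => of (m (z.1, q))) _ z.2 :=
    HasFDerivAt.comp (g := fun z => of (m z)) z.2 hm.hasFDerivAt
      (hasFDerivAt_prodMk_right z.1 z.2)
  have h2 : HasFDerivAt (fun q => m (z.1, q) i j) _ z.2 :=
    ((entry i j).hasFDerivAt.comp z.2 h1).congr_of_eventuallyEq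
      (Eventually.of_forall fun q => (entry_of i j _).symm)
  have h3 : entry i j (fderiv ℝ (fun z => of (m z)) z (0, v)) = a i j * θ v + b i j * φ v :=
    congrArg (fun f => f v) (h2.unique (h i j))
  rw [h3, map_add, map_smul, map_smul, entry_of, entry_of, smul_eq_mul, smul_eq_mul]
  ring

end MatrixAlgebra

open MatrixAlgebra

/-- Frobenius' theorem for the system `dY = (m₁ θ₁ + m₂ θ₂) Y` in terms of a coframing. -/
theorem exists_fundamental_matrix {n : ℕ} {U : Set Plane} {θ₁ θ₂ : Plane → Plane →L[ℝ] ℝ}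
    {K₁ K₂ : Plane → ℝ} (hθ : IsCoframing U θ₁ θ₂ K₁ K₂) {t₀ : Param} {p : Plane} (hp : p ∈ U)
    {O : Set (Param × Plane)} (hO : O ∈ 𝓝 (t₀, p))
    {m₁ m₂ m₁₁ m₁₂ m₂₁ m₂₂ : Param × Plane → Matrix (Fin n) (Fin n) ℝ}
    (hm₁ : ∀ i j, ContDiffOn ℝ ∞ (fun z => m₁ z i j) O)
    (hm₂ : ∀ i j, ContDiffOn ℝ ∞ (fun z => m₂ z i j) O)
    (hm₁' : ∀ z ∈ O, ∀ i j, HasFrameDeriv (θ₁ z.2) (θ₂ z.2) (fun q => m₁ (z.1, q) i j)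
      (m₁₁ z i j) (m₁₂ z i j) z.2)
    (hm₂' : ∀ z ∈ O, ∀ i j, HasFrameDeriv (θ₁ z.2) (θ₂ z.2) (fun q => m₂ (z.1, q) i j)
      (m₂₁ z i j) (m₂₂ z i j) z.2)
    (hint : ∀ z ∈ O, K₁ z.2 • m₁ z - K₂ z.2 • m₂ z - m₁₂ z + m₂₁ z =
      m₁ z * m₂ z - m₂ z * m₁ z) :
    ∃ r > 0, ball t₀ r ×ˢ ball p r ⊆ O ∩ Prod.snd ⁻¹' U ∧
      ∃ Φ : Param × Plane → Matrix (Fin n) (Fin n) ℝ,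
        (∀ i j, ContDiffOn ℝ ∞ (fun z => Φ z i j) (ball t₀ r ×ˢ ball p r)) ∧
        (∀ t, Φ (t, p) = 1) ∧
        ∀ t ∈ ball t₀ r, ∀ q ∈ ball p r, ∀ i j, HasFrameDeriv (θ₁ q) (θ₂ q)
          (fun q => Φ (t, q) i j) ((m₁ (t, q) * Φ (t, q)) i j) ((m₂ (t, q) * Φ (t, q)) i j) q := by
  set O' : Set (Param × Plane) := interior O ∩ Prod.snd ⁻¹' U with hO'
  have hO'o : IsOpen O' := isOpen_interior.inter (hθ.isOpen.preimage continuous_snd)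
  have hO'n : O' ∈ 𝓝 (t₀, p) := hO'o.mem_nhds ⟨mem_interior_iff_mem_nhds.2 hO, hp⟩
  have hsub : O' ⊆ O := fun z hz => interior_subset hz.1
  have hsm₁ := (contDiffOn_of hm₁).mono hsub
  have hsm₂ := (contDiffOn_of hm₂).mono hsub
  have hθ₁ : ContDiffOn ℝ ∞ (fun z : Param × Plane => θ₁ z.2) O' :=
    hθ.smooth₁.comp contDiffOn_snd fun z hz => hz.2
  have hθ₂ : ContDiffOn ℝ ∞ (fun z : Param × Plane => θ₂ z.2) O' :=
    hθ.smooth₂.comp contDiffOn_snd fun z hz => hz.2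
  let M : Param × Plane → Plane →L[ℝ] MatrixAlgebra n := fun z =>
    (θ₁ z.2).smulRight (of (m₁ z)) + (θ₂ z.2).smulRight (of (m₂ z))
  have hM : ContDiffOn ℝ ∞ M O' := (hθ₁.smulRight hsm₁).add (hθ₂.smulRight hsm₂)
  -- The condition is `dm = m ∧ m` for `m = m₁ θ₁ + m₂ θ₂`. By the structure equations, `hint` is
  -- its `θ₁ ∧ θ₂` coefficient; `m₁₁` and `m₂₂` drop out.
  have hint' : ∀ z ∈ O', IsIntegrableAt M z := by
    intro z hz v w
    have hd₁ : DifferentiableAt ℝ (fun z => of (m₁ z)) z :=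
      (hsm₁.contDiffAt (hO'o.mem_nhds hz)).differentiableAt (by simp)
    have hd₂ : DifferentiableAt ℝ (fun z => of (m₂ z)) z :=
      (hsm₂.contDiffAt (hO'o.mem_nhds hz)).differentiableAt (by simp)
    have ht₁ : HasFDerivAt θ₁ (fderiv ℝ θ₁ z.2) z.2 :=
      ((hθ.smooth₁.contDiffAt (hθ.isOpen.mem_nhds hz.2)).differentiableAt
        (by simp)).hasFDerivAt
    have ht₂ : HasFDerivAt θ₂ (fderiv ℝ θ₂ z.2) z.2 :=
      ((hθ.smooth₂.contDiffAt (hθ.isOpen.mem_nhds hz.2)).differentiableAt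
        (by simp)).hasFDerivAt
    have hMd : DifferentiableAt ℝ M z :=
      (hM.contDiffAt (hO'o.mem_nhds hz)).differentiableAt (by simp)
    have key : ∀ x y, fderiv ℝ M z (0, x) y = fderiv ℝ θ₁ z.2 x y • of (m₁ z) +
        θ₁ z.2 y • (θ₁ z.2 x • of (m₁₁ z) + θ₂ z.2 x • of (m₁₂ z)) +
        (fderiv ℝ θ₂ z.2 x y • of (m₂ z) + θ₂ z.2 y • (θ₁ z.2 x • of (m₂₁ z) + θ₂ z.2 x • of (m₂₂ z))) := fun x y => by
      have e1 : HasFDerivAt (fun z => M z y) _ z :=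
        HasFDerivAt.comp (g := fun f : Plane →L[ℝ] MatrixAlgebra n => f y) z
          (ContinuousLinearMap.apply ℝ (MatrixAlgebra n) y).hasFDerivAt hMd.hasFDerivAt
      have c1 : HasFDerivAt (fun z : Param × Plane => θ₁ z.2 y) _ z :=
        ((ContinuousLinearMap.apply ℝ ℝ y).hasFDerivAt.comp z.2 ht₁).comp z hasFDerivAt_snd
      have c2 : HasFDerivAt (fun z : Param × Plane => θ₂ z.2 y) _ z :=
        ((ContinuousLinearMap.apply ℝ ℝ y).hasFDerivAt.comp z.2 ht₂).comp z hasFDerivAt_snd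
      have e2 : HasFDerivAt (fun z => M z y) _ z :=
        (c1.smul hd₁.hasFDerivAt).add (c2.smul hd₂.hasFDerivAt)
      have e3 : fderiv ℝ M z (0, x) y = _ := congrArg (fun f => f (0, x)) (e1.unique e2)
      have f1 := fderiv_of hd₁ (hm₁' z (hsub hz)) x
      have f2 := fderiv_of hd₂ (hm₂' z (hsub hz)) x
      simp only [ContinuousLinearMap.comp_apply, ContinuousLinearMap.apply_apply,
        _root_.add_apply, _root_.smul_apply, ContinuousLinearMap.smulRight_apply,
        ContinuousLinearMap.coe_snd', f1, f2] at e3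
      rw [e3]
      abel
    have hi := hint z (hsub hz)
    have x1 := hθ.ext₁ z.2 hz.2 v w
    have x2 := hθ.ext₂ z.2 hz.2 v w
    have y1 : fderiv ℝ θ₁ z.2 v w = fderiv ℝ θ₁ z.2 w v +
      K₁ z.2 * (θ₁ z.2 v * θ₂ z.2 w - θ₁ z.2 w * θ₂ z.2 v) := by linarith
    have y2 : fderiv ℝ θ₂ z.2 v w = fderiv ℝ θ₂ z.2 w v +
      K₂ z.2 * (θ₂ z.2 v * θ₁ z.2 w - θ₂ z.2 w * θ₁ z.2 v) := by linarith
    have hi' : of (m₁ z) * of (m₂ z) = of (m₂ z) * of (m₁ z) + (K₁ z.2 • of (m₁ z) -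
        K₂ z.2 • of (m₂ z) - of (m₁₂ z) + of (m₂₁ z)) := by
      rw [← of_mul, ← of_mul, ← of_smul, ← of_smul, ← of_sub, ← of_sub, ← of_add, hi, of_sub]
      abel
    rw [key, key, y1, y2]
    simp only [M, _root_.add_apply, ContinuousLinearMap.smulRight_apply, add_mul, mul_add,
      smul_mul_assoc, mul_smul_comm, hi']
    module
  obtain ⟨r, hr, hsubr, Φ, hΦ, hΦ1, hΦ'⟩ := exists_fundamental_solution hO'n hM hint'
  refine ⟨r, hr, fun z hz => ⟨hsub (hsubr hz), (hsubr hz).2⟩, fun z => toMatrix (Φ z),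
    fun i j => (entry i j).contDiff.comp_contDiffOn hΦ, fun t => by simp only [hΦ1, toMatrix_one],
    fun t ht q hq i j => ?_⟩
  refine ((entry i j).hasFDerivAt.comp q (hΦ' t ht q hq)).congr_fderiv ?_
  ext v
  simp only [ContinuousLinearMap.comp_apply, ContinuousLinearMap.flip_apply,
    ContinuousLinearMap.mul_apply', M, _root_.add_apply, ContinuousLinearMap.smulRight_apply,
    map_add, map_smul, entry_of_mul, _root_.smul_apply, smul_eq_mul]
  ring

end Matrix

end CoframeSystems

/-! ### The linear system for the metric coefficients and its three parameters. -/

noncomputable section Potentials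

open Set Filter Topology Metric

/-- A family of pairs `(u, v)` of positive functions, parametrized by a ball about `t₀`, with
`du = w θ₁ + 2 (1 - K₁) u θ₂`, `dv = 2 (1 - K₂) v θ₁ + w' θ₂` and `w + w' = 2 (u + v + 1)`,
in which different parameters give different values of `(u, v, w)` at `p`.
The metrics `u⁻¹ θ₁² + v⁻¹ θ₂²` then have curvature `1`. -/
structure IsPotentialFamily (θ₁ θ₂ : Plane → Plane →L[ℝ] ℝ) (K₁ K₂ : Plane → ℝ) (p : Plane)
    (t₀ : Param) (r : ℝ) (u v w w' : Param × Plane → ℝ) : Prop where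
  smooth_u : ContDiffOn ℝ ∞ u (ball t₀ r ×ˢ ball p r)
  smooth_v : ContDiffOn ℝ ∞ v (ball t₀ r ×ˢ ball p r)
  pos_u : ∀ z ∈ ball t₀ r ×ˢ ball p r, 0 < u z
  pos_v : ∀ z ∈ ball t₀ r ×ˢ ball p r, 0 < v z
  deriv_u : ∀ t ∈ ball t₀ r, ∀ q ∈ ball p r, HasFrameDeriv (θ₁ q) (θ₂ q) (fun q => u (t, q))
    (w (t, q)) (2 * (1 - K₁ q) * u (t, q)) q
  deriv_v : ∀ t ∈ ball t₀ r, ∀ q ∈ ball p r, HasFrameDeriv (θ₁ q) (θ₂ q) (fun q => v (t, q))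
    (2 * (1 - K₂ q) * v (t, q)) (w' (t, q)) q
  gauss : ∀ z ∈ ball t₀ r ×ˢ ball p r, w z + w' z = 2 * (u z + v z + 1)
  separates : ∀ s t, u (s, p) = u (t, p) → v (s, p) = v (t, p) → w (s, p) = w (t, p) → s = t

/-- Separation is required for all parameters, not only those in the ball, so recovering `w` from
`w'` at `p` needs the Gauss relation there for every `t`; this is `hg`. -/
lemma IsPotentialFamily.swap {θ₁ θ₂ : Plane → Plane →L[ℝ] ℝ} {K₁ K₂ : Plane → ℝ} {p : Plane}
    {t₀ : Param} {r : ℝ} {u v w w' : Param × Plane → ℝ}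
    (h : IsPotentialFamily θ₁ θ₂ K₁ K₂ p t₀ r u v w w')
    (hg : ∀ t, w (t, p) + w' (t, p) = 2 * (u (t, p) + v (t, p) + 1)) :
    IsPotentialFamily θ₂ θ₁ K₂ K₁ p t₀ r v u w' w where
  smooth_u := h.smooth_v
  smooth_v := h.smooth_u
  pos_u := h.pos_v
  pos_v := h.pos_u
  deriv_u t ht q hq := (h.deriv_v t ht q hq).swap
  deriv_v t ht q hq := (h.deriv_u t ht q hq).swap
  gauss z hz := by linarith [h.gauss z hz]
  separates s t hv hu hw := h.separates s t hu hv (by linarith [hg s, hg t])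

/-- Solutions of an integrable system `dY = (m₁ θ₁ + m₂ θ₂) Y` of size four with `Y₀ = 1`. -/
lemma exists_affine_solution {U : Set Plane} {θ₁ θ₂ : Plane → Plane →L[ℝ] ℝ}
    {K₁ K₂ : Plane → ℝ} (hθ : IsCoframing U θ₁ θ₂ K₁ K₂) {p : Plane} (hp : p ∈ U) (t₀ : Param)
    {m₁ m₂ m₁₁ m₁₂ m₂₁ m₂₂ : Plane → Matrix (Fin 4) (Fin 4) ℝ}
    (hm₁ : ∀ i j, ContDiffOn ℝ ∞ (fun q => m₁ q i j) U)
    (hm₂ : ∀ i j, ContDiffOn ℝ ∞ (fun q => m₂ q i j) U)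
    (hm₁' : ∀ q ∈ U, ∀ i j, HasFrameDeriv (θ₁ q) (θ₂ q) (fun q => m₁ q i j)
      (m₁₁ q i j) (m₁₂ q i j) q)
    (hm₂' : ∀ q ∈ U, ∀ i j, HasFrameDeriv (θ₁ q) (θ₂ q) (fun q => m₂ q i j)
      (m₂₁ q i j) (m₂₂ q i j) q)
    (hint : ∀ q ∈ U, K₁ q • m₁ q - K₂ q • m₂ q - m₁₂ q + m₂₁ q = m₁ q * m₂ q - m₂ q * m₁ q)
    (h0₁ : ∀ q ∈ U, ∀ j, m₁ q 0 j = 0) (h0₂ : ∀ q ∈ U, ∀ j, m₂ q 0 j = 0) :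
    ∃ r > 0, ball p r ⊆ U ∧ ∃ Y : Param × Plane → Fin 4 → ℝ,
      (∀ i, ContDiffOn ℝ ∞ (fun z => Y z i) (ball t₀ r ×ˢ ball p r)) ∧
      (∀ t, Y (t, p) = ![1, t 0, t 1, t 2]) ∧
      (∀ z ∈ ball t₀ r ×ˢ ball p r, Y z 0 = 1) ∧
      ∀ t ∈ ball t₀ r, ∀ q ∈ ball p r, ∀ i, HasFrameDeriv (θ₁ q) (θ₂ q)
        (fun q => Y (t, q) i) ((m₁ q).mulVec (Y (t, q)) i) ((m₂ q).mulVec (Y (t, q)) i) q := by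
  have hmaps : MapsTo Prod.snd ((univ : Set Param) ×ˢ U) U := fun z hz => hz.2
  obtain ⟨r, hr, hsub, Φ, hΦ, hΦ1, hΦ'⟩ := exists_fundamental_matrix hθ (t₀ := t₀) hp
    (O := univ ×ˢ U) ((isOpen_univ.prod hθ.isOpen).mem_nhds ⟨mem_univ _, hp⟩)
    (m₁ := fun z => m₁ z.2) (m₂ := fun z => m₂ z.2) (m₁₁ := fun z => m₁₁ z.2)
    (m₁₂ := fun z => m₁₂ z.2) (m₂₁ := fun z => m₂₁ z.2) (m₂₂ := fun z => m₂₂ z.2)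
    (fun i j => (hm₁ i j).comp contDiffOn_snd hmaps)
    (fun i j => (hm₂ i j).comp contDiffOn_snd hmaps)
    (fun z hz => hm₁' z.2 hz.2) (fun z hz => hm₂' z.2 hz.2) (fun z hz => hint z.2 hz.2)
  have hU : ball p r ⊆ U := fun q hq =>
    (hsub (mk_mem_prod (mem_ball_self hr : t₀ ∈ ball t₀ r) hq)).2
  -- The leading `1` makes the affine system for `(u, v, w)` linear. It persists because the zeroth
  -- rows of `m₁` and `m₂` vanish.
  let c : Param → Fin 4 → ℝ := fun t => ![1, t 0, t 1, t 2]
  have hc : ∀ j, ContDiff ℝ ∞ fun t => c t j := by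
    intro j
    fin_cases j <;> simp [c] <;> fun_prop
  have hY' : ∀ t ∈ ball t₀ r, ∀ q ∈ ball p r, ∀ i, HasFrameDeriv (θ₁ q) (θ₂ q)
      (fun q => (Φ (t, q)).mulVec (c t) i) ((m₁ q).mulVec ((Φ (t, q)).mulVec (c t)) i)
      ((m₂ q).mulVec ((Φ (t, q)).mulVec (c t)) i) q := fun t ht q hq i => by
    rw [Matrix.mulVec_mulVec, Matrix.mulVec_mulVec]
    refine HasFrameDeriv.sum (s := Finset.univ) (f := fun j q => Φ (t, q) i j * c t j)
      (a := fun j => (m₁ q * Φ (t, q)) i j * c t j)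
      (b := fun j => (m₂ q * Φ (t, q)) i j * c t j) fun j _ => ?_
    refine ((hΦ' t ht q hq i j).mul (HasFrameDeriv.const (c t j))).congr_coeff ?_ ?_ <;> simp
  refine ⟨r, hr, hU, fun z => (Φ z).mulVec (c z.1), fun i => ?_, fun t => ?_, ?_, hY'⟩
  · exact ContDiffOn.sum (s := Finset.univ) (f := fun j z => Φ z i j * c z.1 j)
      fun j _ => (hΦ i j).mul ((hc j).comp_contDiffOn contDiffOn_fst)
  · simp only [hΦ1, Matrix.one_mulVec, c]
  · rintro ⟨t, q⟩ ⟨ht, hq⟩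
    have h0 : ∀ x ∈ ball p r, HasFDerivAt (fun q => (Φ (t, q)).mulVec (c t) 0)
        (0 : Plane →L[ℝ] ℝ) x := fun x hx => by
      refine (hY' t ht x hx 0).congr_fderiv ?_
      simp [Matrix.mulVec, dotProduct, h0₁ x (hU hx), h0₂ x (hU hx)]
    have h1 := (convex_ball p r).is_const_of_fderivWithin_eq_zero (𝕜 := ℝ)
      (fun x hx => (h0 x hx).differentiableAt.differentiableWithinAt)
      (fun x hx => (h0 x hx).hasFDerivWithinAt.fderivWithin
        (isOpen_ball.uniqueDiffWithinAt hx)) hq (mem_ball_self hr)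
    simp only at h1 ⊢
    rw [h1, hΦ1, Matrix.one_mulVec]
    rfl

/-- The base point of the parameter space. -/
def baseParam : Param := !₂[1, 1, 0]

/-- The solution is read as `Y = (1, u, v, w)`, with `w'` defined by the Gauss relation. Since
`baseParam` gives `u = v = 1` at `p`, both stay positive after shrinking the balls. -/
lemma isPotentialFamily_of_affine {U : Set Plane} {θ₁ θ₂ : Plane → Plane →L[ℝ] ℝ}
    {K₁ K₂ : Plane → ℝ} {p : Plane}
    {m₁ m₂ : Plane → Matrix (Fin 4) (Fin 4) ℝ}
    (h : ∃ r > 0, ball p r ⊆ U ∧ ∃ Y : Param × Plane → Fin 4 → ℝ,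
      (∀ i, ContDiffOn ℝ ∞ (fun z => Y z i) (ball baseParam r ×ˢ ball p r)) ∧
      (∀ t, Y (t, p) = ![1, t 0, t 1, t 2]) ∧
      (∀ z ∈ ball baseParam r ×ˢ ball p r, Y z 0 = 1) ∧
      ∀ t ∈ ball baseParam r, ∀ q ∈ ball p r, ∀ i, HasFrameDeriv (θ₁ q) (θ₂ q)
        (fun q => Y (t, q) i) ((m₁ q).mulVec (Y (t, q)) i) ((m₂ q).mulVec (Y (t, q)) i) q)
    (h₁ : ∀ q ∈ U, ∀ Y : Fin 4 → ℝ, Y 0 = 1 → (m₁ q).mulVec Y 1 = Y 3 ∧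
      (m₁ q).mulVec Y 2 = 2 * (1 - K₂ q) * Y 2)
    (h₂ : ∀ q ∈ U, ∀ Y : Fin 4 → ℝ, Y 0 = 1 → (m₂ q).mulVec Y 1 = 2 * (1 - K₁ q) * Y 1 ∧
      (m₂ q).mulVec Y 2 = 2 * (Y 1 + Y 2 + 1) - Y 3) :
    ∃ r > 0, ball p r ⊆ U ∧ ∃ u v w w' : Param × Plane → ℝ,
      (∀ z, w z + w' z = 2 * (u z + v z + 1)) ∧
      IsPotentialFamily θ₁ θ₂ K₁ K₂ p baseParam r u v w w' := by
  obtain ⟨r, hr, hU, Y, hY, hYp, hY0, hY'⟩ := h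
  have hz₀ : (baseParam, p) ∈ ball baseParam r ×ˢ ball p r :=
    ⟨mem_ball_self hr, mem_ball_self hr⟩
  have hnhds : ball baseParam r ×ˢ ball p r ∈ 𝓝 (baseParam, p) :=
    (isOpen_ball.prod isOpen_ball).mem_nhds hz₀
  have hpos : ∀ᶠ z in 𝓝 (baseParam, p), 0 < Y z 1 ∧ 0 < Y z 2 := by
    have h1 := ((hY 1).continuousOn.continuousAt hnhds).eventually_const_lt (u := 0)
      (by simp [hYp, baseParam])
    have h2 := ((hY 2).continuousOn.continuousAt hnhds).eventually_const_lt (u := 0)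
      (by simp [hYp, baseParam])
    exact h1.and h2
  obtain ⟨ε, hε, hb⟩ := Metric.mem_nhds_iff.1 (inter_mem hnhds hpos)
  rw [← ball_prod_same] at hb
  have hbt : ∀ t ∈ ball baseParam ε, t ∈ ball baseParam r := fun t ht =>
    (hb (mk_mem_prod ht (mem_ball_self hε))).1.1
  have hbq : ∀ q ∈ ball p ε, q ∈ ball p r := fun q hq =>
    (hb (mk_mem_prod (mem_ball_self hε) hq)).1.2
  have hbb : ball baseParam ε ×ˢ ball p ε ⊆ ball baseParam r ×ˢ ball p r := fun z hz => (hb hz).1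
  refine ⟨ε, hε, fun q hq => hU (hbq q hq), fun z => Y z 1, fun z => Y z 2, fun z => Y z 3,
    fun z => 2 * (Y z 1 + Y z 2 + 1) - Y z 3, fun z => by ring,
    (hY 1).mono hbb, (hY 2).mono hbb, fun z hz => (hb hz).2.1, fun z hz => (hb hz).2.2,
    fun t ht q hq => ?_, fun t ht q hq => ?_, fun z hz => by ring, fun s t h1 h2 h3 => ?_⟩
  · have h0 := hY0 (t, q) ⟨hbt t ht, hbq q hq⟩
    exact (hY' t (hbt t ht) q (hbq q hq) 1).congr_coeff (h₁ q (hU (hbq q hq)) _ h0).1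
      (h₂ q (hU (hbq q hq)) _ h0).1
  · have h0 := hY0 (t, q) ⟨hbt t ht, hbq q hq⟩
    exact (hY' t (hbt t ht) q (hbq q hq) 2).congr_coeff (h₁ q (hU (hbq q hq)) _ h0).2
      (h₂ q (hU (hbq q hq)) _ h0).2
  · simp only [hYp] at h1 h2 h3
    ext i
    fin_cases i
    · simpa using h1
    · simpa using h2
    · simpa using h3

/-- Here `d²u = 0` gives `w` as the `θ₂`-derivative of `w`. From `d²v = 0`, the Gauss relation and
the `θ₂`-derivative `2 (K - 1)` of `K`, the `θ₁`-derivative of `w` is `-4 - 4u - 2v + 4w + K (2 + 2u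
- w)`. These are the last rows of `C` and `A + K N`. The other derivative `K'` does not enter the
integrability condition. -/
theorem exists_potentialFamily_typeI {U : Set Plane} {θ₁ θ₂ : Plane → Plane →L[ℝ] ℝ}
    {K : Plane → ℝ} (hθ : IsCoframing U θ₁ θ₂ (fun _ => 1) K) (hK : ContDiffOn ℝ ∞ K U)
    {K' : Plane → ℝ}
    (hK' : ∀ q ∈ U, HasFrameDeriv (θ₁ q) (θ₂ q) K (K' q) (2 * (K q - 1)) q)
    {p : Plane} (hp : p ∈ U) :
    ∃ r > 0, ball p r ⊆ U ∧ ∃ u v w w' : Param × Plane → ℝ,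
      (∀ z, w z + w' z = 2 * (u z + v z + 1)) ∧
      IsPotentialFamily θ₁ θ₂ (fun _ => 1) K p baseParam r u v w w' := by
  let A : Matrix (Fin 4) (Fin 4) ℝ := !![0, 0, 0, 0; 0, 0, 0, 1; 0, 0, 2, 0; -4, -4, -2, 4]
  let N : Matrix (Fin 4) (Fin 4) ℝ := !![0, 0, 0, 0; 0, 0, 0, 0; 0, 0, -2, 0; 2, 2, 0, -1]
  let C : Matrix (Fin 4) (Fin 4) ℝ := !![0, 0, 0, 0; 0, 0, 0, 0; 2, 2, 2, -1; 0, 0, 0, 1]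
  refine isPotentialFamily_of_affine (m₁ := fun q => A + K q • N) (m₂ := fun _ => C)
    (exists_affine_solution hθ hp baseParam (m₁₁ := fun q => K' q • N)
      (m₁₂ := fun q => (2 * (K q - 1)) • N) (m₂₁ := fun _ => 0) (m₂₂ := fun _ => 0)
      (fun i j => contDiffOn_const.add (hK.mul contDiffOn_const)) (fun i j => contDiffOn_const)
      (fun q hq i j => ?_) (fun q hq i j => HasFrameDeriv.const _) (fun q hq => ?_)
      (fun q hq j => ?_) (fun q hq j => ?_)) (fun q hq Y hY => ?_) (fun q hq Y hY => ?_)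
  · refine ((HasFrameDeriv.const (A i j)).add
      ((hK' q hq).mul (HasFrameDeriv.const (N i j)))).congr_coeff ?_ ?_ <;> simp
  · ext i j
    fin_cases i <;> fin_cases j <;>
      simp [A, N, C] <;> ring
  · fin_cases j <;> simp [A, N]
  · fin_cases j <;> simp [C]
  · constructor <;>
      simp [-mul_eq_mul_right_iff, A, N, Matrix.mulVec, dotProduct, Fin.sum_univ_four] <;> ring
  · constructor <;>
      simp [-mul_eq_mul_right_iff, C, Matrix.mulVec, dotProduct, Fin.sum_univ_four, hY]
    ring

/-- With `K₁ = K₂ = -2` the factors `2 (1 - Kᵢ)` are `6`, and `d²u = d²v = 0` gives `dw = (-8 - 8u -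
8v + 6w) θ₁ + (12u + 4w) θ₂`. The system has constant coefficients, so integrability is a single
matrix identity. -/
theorem exists_potentialFamily_typeII {U : Set Plane} {θ₁ θ₂ : Plane → Plane →L[ℝ] ℝ}
    (hθ : IsCoframing U θ₁ θ₂ (fun _ => -2) fun _ => -2) {p : Plane} (hp : p ∈ U) :
    ∃ r > 0, ball p r ⊆ U ∧ ∃ u v w w' : Param × Plane → ℝ,
      (∀ z, w z + w' z = 2 * (u z + v z + 1)) ∧
      IsPotentialFamily θ₁ θ₂ (fun _ => -2) (fun _ => -2) p baseParam r u v w w' := by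
  let A : Matrix (Fin 4) (Fin 4) ℝ := !![0, 0, 0, 0; 0, 0, 0, 1; 0, 0, 6, 0; -8, -8, -8, 6]
  let C : Matrix (Fin 4) (Fin 4) ℝ := !![0, 0, 0, 0; 0, 6, 0, 0; 2, 2, 2, -1; 0, 12, 0, 4]
  refine isPotentialFamily_of_affine (m₁ := fun _ => A) (m₂ := fun _ => C)
    (exists_affine_solution hθ hp baseParam (m₁₁ := fun _ => 0)
      (m₁₂ := fun _ => 0) (m₂₁ := fun _ => 0) (m₂₂ := fun _ => 0)
      (fun i j => contDiffOn_const) (fun i j => contDiffOn_const)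
      (fun q hq i j => HasFrameDeriv.const _) (fun q hq i j => HasFrameDeriv.const _)
      (fun q hq => ?_) (fun q hq j => ?_) (fun q hq j => ?_))
      (fun q hq Y hY => ?_) (fun q hq Y hY => ?_)
  · ext i j
    fin_cases i <;> fin_cases j <;>
      simp [A, C] <;> ring
  · fin_cases j <;> simp [A]
  · fin_cases j <;> simp [C]
  · constructor <;>
      simp [-mul_eq_mul_right_iff, A, Matrix.mulVec, dotProduct, Fin.sum_univ_four] <;> ring
  · constructor <;>
      simp [-mul_eq_mul_right_iff, C, Matrix.mulVec, dotProduct, Fin.sum_univ_four, hY] <;> ring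

end Potentials

/-! ### The adapted frame: structure equations, flatness, integration. -/

noncomputable section MovingFrames

open Set Filter Topology Metric

/-- The coefficient of `θ₁` in the connection matrix of the adapted frame `(e₁, e₂, n, x)`, for
the third fundamental form `(a θ₁)² + (b θ₂)²` and `c = a / b`, `f = a / A`. -/
def connection₁ (c a f : ℝ) : Matrix (Fin 4) (Fin 4) ℝ :=
  !![0, c, a, 0; -c, 0, 0, 0; -a, 0, 0, 0; f, 0, 0, 0]

/-- The coefficient of `θ₂` in the connection matrix of the adapted frame `(e₁, e₂, n, x)`, for
the third fundamental form `(a θ₁)² + (b θ₂)²` and `c = b / a`, `f = b / B`. -/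
def connection₂ (c b f : ℝ) : Matrix (Fin 4) (Fin 4) ℝ :=
  !![0, -c, 0, 0; c, 0, b, 0; 0, -b, 0, 0; 0, f, 0, 0]

lemma HasFrameDeriv.connection₁ {θ φ : Plane →L[ℝ] ℝ} {c a f : Plane → ℝ}
    {c₁ c₂ a₁ a₂ f₁ f₂ : ℝ} {q : Plane} (hc : HasFrameDeriv θ φ c c₁ c₂ q)
    (ha : HasFrameDeriv θ φ a a₁ a₂ q) (hf : HasFrameDeriv θ φ f f₁ f₂ q) (i j : Fin 4) :
    HasFrameDeriv θ φ (fun q => _root_.connection₁ (c q) (a q) (f q) i j)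
      (_root_.connection₁ c₁ a₁ f₁ i j) (_root_.connection₁ c₂ a₂ f₂ i j) q := by
  fin_cases i <;> fin_cases j <;>
    first | exact HasFrameDeriv.const 0 | exact hc | exact ha | exact hf | exact hc.neg |
      exact ha.neg

lemma HasFrameDeriv.connection₂ {θ φ : Plane →L[ℝ] ℝ} {c a f : Plane → ℝ}
    {c₁ c₂ a₁ a₂ f₁ f₂ : ℝ} {q : Plane} (hc : HasFrameDeriv θ φ c c₁ c₂ q)
    (ha : HasFrameDeriv θ φ a a₁ a₂ q) (hf : HasFrameDeriv θ φ f f₁ f₂ q) (i j : Fin 4) :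
    HasFrameDeriv θ φ (fun q => _root_.connection₂ (c q) (a q) (f q) i j)
      (_root_.connection₂ c₁ a₁ f₁ i j) (_root_.connection₂ c₂ a₂ f₂ i j) q := by
  fin_cases i <;> fin_cases j <;>
    first | exact HasFrameDeriv.const 0 | exact hc | exact ha | exact hf | exact hc.neg |
      exact ha.neg

lemma contDiffOn_connection₁ {O : Set (Param × Plane)} {c a f : Param × Plane → ℝ}
    (hc : ContDiffOn ℝ ∞ c O) (ha : ContDiffOn ℝ ∞ a O) (hf : ContDiffOn ℝ ∞ f O) (i j : Fin 4) :
    ContDiffOn ℝ ∞ (fun z => connection₁ (c z) (a z) (f z) i j) O := by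
  fin_cases i <;> fin_cases j <;>
    first | exact contDiffOn_const (c := (0 : ℝ)) | exact hc | exact ha | exact hf |
      exact hc.neg | exact ha.neg

lemma contDiffOn_connection₂ {O : Set (Param × Plane)} {c a f : Param × Plane → ℝ}
    (hc : ContDiffOn ℝ ∞ c O) (ha : ContDiffOn ℝ ∞ a O) (hf : ContDiffOn ℝ ∞ f O) (i j : Fin 4) :
    ContDiffOn ℝ ∞ (fun z => connection₂ (c z) (a z) (f z) i j) O := by
  fin_cases i <;> fin_cases j <;>
    first | exact contDiffOn_const (c := (0 : ℝ)) | exact hc | exact ha | exact hf |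
      exact hc.neg | exact ha.neg

/-- The equations of Gauss and Codazzi, as the flatness of the connection of the adapted frame. -/
lemma connection_flat {a b α β k l A B : ℝ} (ha : a ≠ 0) (hb : b ≠ 0) (hA : A ≠ 0) (hB : B ≠ 0)
    (hG : α * b ^ 3 + β * a ^ 3 = -(a * b ^ 3 + a ^ 3 * b + a ^ 3 * b ^ 3)) :
    k • connection₁ (a / b) a (a / A) - l • connection₂ (b / a) b (b / B) -
      connection₁ (((k - 1) * a * b - a * β) / b ^ 2) ((k - 1) * a)
        (((k - 1) * a * A - a * (A * (A - B) / B)) / A ^ 2) +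
      connection₂ (((l - 1) * b * a - b * α) / a ^ 2) ((l - 1) * b)
        (((l - 1) * b * B - b * (B * (B - A) / A)) / B ^ 2) =
      connection₁ (a / b) a (a / A) * connection₂ (b / a) b (b / B) -
        connection₂ (b / a) b (b / B) * connection₁ (a / b) a (a / A) := by
  -- Only the entries pairing `e₁` with `e₂` use the Gauss equation `hG`. The others hold
  -- identically: the Codazzi equations are already built into the derivatives `(k - 1) a`, `(l - 1)
  -- b` and into those of `A` and `B`.
  ext i j
  fin_cases i <;> fin_cases j <;> simp [connection₁, connection₂] <;> field_simp <;>
    first | ring1 | linear_combination hG | linear_combination -hG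

/-- The rows of a matrix function of size four, without their last entries. -/
def frameRow (Φ : Param × Plane → Matrix (Fin 4) (Fin 4) ℝ) (i : Fin 4) (z : Param × Plane) :
    Space :=
  WithLp.toLp 2 fun k : Fin 3 => Φ z i k.castSucc

lemma frameRow_apply (Φ : Param × Plane → Matrix (Fin 4) (Fin 4) ℝ) (i : Fin 4)
    (z : Param × Plane) (k : Fin 3) : frameRow Φ i z k = Φ z i k.castSucc := rfl

/-- The coefficient matrices multiply `Φ` from the left, so they combine its rows, and truncating
every row to three entries preserves the equations. -/
lemma hasFDerivAt_frameRow {Φ : Param × Plane → Matrix (Fin 4) (Fin 4) ℝ} {t : Param} {q : Plane}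
    {θ φ : Plane →L[ℝ] ℝ} {m₁ m₂ : Matrix (Fin 4) (Fin 4) ℝ}
    (h : ∀ i j, HasFrameDeriv θ φ (fun q => Φ (t, q) i j) ((m₁ * Φ (t, q)) i j)
      ((m₂ * Φ (t, q)) i j) q) (i : Fin 4) :
    HasFDerivAt (fun q => frameRow Φ i (t, q)) (θ.smulRight (∑ l, m₁ i l • frameRow Φ l (t, q)) +
      φ.smulRight (∑ l, m₂ i l • frameRow Φ l (t, q))) q := by
  rw [← hasFDerivWithinAt_univ, hasFDerivWithinAt_euclidean]
  intro k
  rw [hasFDerivWithinAt_univ]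
  refine HasFDerivAt.congr_fderiv (h i k.castSucc) ?_
  ext v
  simp [frameRow_apply, Matrix.mul_apply, Fin.sum_univ_four]
  ring

/-- The first three rows of the fundamental matrix form an orthonormal frame. -/
lemma orthonormal_frameRow {θ₁ θ₂ : Plane → Plane →L[ℝ] ℝ}
    {Φ : Param × Plane → Matrix (Fin 4) (Fin 4) ℝ} {t : Param} {p : Plane} {r : ℝ} (hr : 0 < r)
    {c a f c' b f' : Plane → ℝ} (h1 : Φ (t, p) = 1)
    (h : ∀ q ∈ ball p r, ∀ i j, HasFrameDeriv (θ₁ q) (θ₂ q) (fun q => Φ (t, q) i j)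
      ((connection₁ (c q) (a q) (f q) * Φ (t, q)) i j)
      ((connection₂ (c' q) (b q) (f' q) * Φ (t, q)) i j) q) {q : Plane} (hq : q ∈ ball p r) :
    Orthonormal ℝ fun i : Fin 3 => frameRow Φ i.castSucc (t, q) := by
  let Ψ : Plane → Matrix (Fin 3) (Fin 3) ℝ := fun q => Matrix.of fun i j =>
    Φ (t, q) i.castSucc j.castSucc
  have hconst : (Ψ q).transpose * Ψ q = 1 := by
    ext j k
    -- The upper left 3 × 3 blocks of both connection matrices are skew and the rest of their first
    -- three rows vanishes, so `Ψᵀ Ψ` is constant, equal to its value `1` at `p`.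
    have h0 : ∀ x ∈ ball p r, HasFDerivAt (fun x => ∑ i : Fin 3, Φ (t, x) i.castSucc j.castSucc *
        Φ (t, x) i.castSucc k.castSucc) (0 : Plane →L[ℝ] ℝ) x := fun x hx => by
      have h2 := HasFrameDeriv.sum (s := (Finset.univ : Finset (Fin 3))) fun i _ =>
        (h x hx i.castSucc j.castSucc).mul (h x hx i.castSucc k.castSucc)
      refine HasFDerivAt.congr_fderiv h2 ?_
      ext v
      simp [Fin.sum_univ_three, Matrix.mul_apply, Fin.sum_univ_four, connection₁, connection₂]
      ring
    have h3 := (convex_ball p r).is_const_of_fderivWithin_eq_zero (𝕜 := ℝ)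
      (fun x hx => (h0 x hx).differentiableAt.differentiableWithinAt)
      (fun x hx => (h0 x hx).hasFDerivWithinAt.fderivWithin
        (isOpen_ball.uniqueDiffWithinAt hx)) hq (mem_ball_self hr)
    simp only [h1] at h3
    rw [Matrix.mul_apply]
    refine h3.trans ?_
    fin_cases j <;> fin_cases k <;> simp [Fin.sum_univ_three, Matrix.one_apply]
  -- The conserved quantity concerns the columns; for a square matrix it gives orthonormality of the
  -- rows.
  have hΨ : Ψ q * (Ψ q).transpose = 1 := mul_eq_one_comm.1 hconst
  rw [orthonormal_iff_ite]
  intro i j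
  have h4 := congrFun (congrFun hΨ j) i
  rw [Matrix.mul_apply, Matrix.one_apply] at h4
  simp only [eq_comm (a := i) (b := j)]
  rw [← h4]
  simp [PiLp.inner_apply, frameRow_apply, Ψ]

/-- Smooth invertible principal curvatures `A`, `B` with `θ₁ = A d'B / (B (B - A))` and
`θ₂ = B d''A / (A (A - B))`. -/
structure IsAdapted (U : Set Plane) (θ₁ θ₂ : Plane → Plane →L[ℝ] ℝ) (A B : Plane → ℝ) : Prop where
  smooth_A : ContDiffOn ℝ ∞ A U
  smooth_B : ContDiffOn ℝ ∞ B U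
  ne_A : ∀ q ∈ U, A q ≠ 0
  ne_B : ∀ q ∈ U, B q ≠ 0
  deriv_A : ∀ q ∈ U, ∃ A₁, HasFrameDeriv (θ₁ q) (θ₂ q) A A₁ (A q * (A q - B q) / B q) q
  deriv_B : ∀ q ∈ U, ∃ B₂, HasFrameDeriv (θ₁ q) (θ₂ q) B (B q * (B q - A q) / A q) B₂ q

/-- Integration of the adapted frame and of the immersion, given a potential family. -/
theorem exists_adapted_frame {U : Set Plane} {θ₁ θ₂ : Plane → Plane →L[ℝ] ℝ}
    {K₁ K₂ A B : Plane → ℝ} (hθ : IsCoframing U θ₁ θ₂ K₁ K₂) (hAB : IsAdapted U θ₁ θ₂ A B)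
    {p : Plane} {t₀ : Param} {r : ℝ} (hr : 0 < r) (hU : ball p r ⊆ U)
    {u v w w' : Param × Plane → ℝ} (huv : IsPotentialFamily θ₁ θ₂ K₁ K₂ p t₀ r u v w w') :
    ∃ ε > 0, ball t₀ ε ⊆ ball t₀ r ∧ ball p ε ⊆ ball p r ∧
      ∃ E : Fin 4 → Param × Plane → Space,
        (∀ i, ContDiffOn ℝ ∞ (E i) (ball t₀ ε ×ˢ ball p ε)) ∧
        ∀ t ∈ ball t₀ ε, ∀ q ∈ ball p ε,
          Orthonormal ℝ (fun i : Fin 3 => E i.castSucc (t, q)) ∧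
          HasFDerivAt (fun q => E 3 (t, q))
            ((θ₁ q).smulRight (((√(u (t, q)))⁻¹ / A q) • E 0 (t, q)) +
              (θ₂ q).smulRight (((√(v (t, q)))⁻¹ / B q) • E 1 (t, q))) q ∧
          HasFDerivAt (fun q => E 2 (t, q))
            ((θ₁ q).smulRight (-(√(u (t, q)))⁻¹ • E 0 (t, q)) +
              (θ₂ q).smulRight (-(√(v (t, q)))⁻¹ • E 1 (t, q))) q := by
  set O : Set (Param × Plane) := ball t₀ r ×ˢ ball p r with hO
  let a : Param × Plane → ℝ := fun z => (√(u z))⁻¹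
  let b : Param × Plane → ℝ := fun z => (√(v z))⁻¹
  have hinvsqrt : ∀ {x : ℝ}, 0 < x → HasDerivAt (fun x => (√x)⁻¹) (-(√x)⁻¹ ^ 3 / 2) x := by
    intro x hx
    refine ((Real.hasDerivAt_sqrt hx.ne').inv (Real.sqrt_pos.2 hx).ne').congr_deriv ?_
    have := (Real.sqrt_pos.2 hx).ne'
    field_simp
  have hsq : ∀ {x : ℝ}, 0 < x → (√x)⁻¹ ^ 2 * x = 1 := fun {x} hx => by
    rw [inv_pow, Real.sq_sqrt hx.le, inv_mul_cancel₀ hx.ne']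
  have ha0 : ∀ z ∈ O, a z ≠ 0 := fun z hz => inv_ne_zero (Real.sqrt_pos.2 (huv.pos_u z hz)).ne'
  have hb0 : ∀ z ∈ O, b z ≠ 0 := fun z hz => inv_ne_zero (Real.sqrt_pos.2 (huv.pos_v z hz)).ne'
  have hau : ∀ z ∈ O, a z ^ 2 * u z = 1 := fun z hz => hsq (huv.pos_u z hz)
  have hbv : ∀ z ∈ O, b z ^ 2 * v z = 1 := fun z hz => hsq (huv.pos_v z hz)
  have has : ContDiffOn ℝ ∞ a O := (huv.smooth_u.sqrt fun z hz => (huv.pos_u z hz).ne').inv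
    fun z hz => (Real.sqrt_pos.2 (huv.pos_u z hz)).ne'
  have hbs : ContDiffOn ℝ ∞ b O := (huv.smooth_v.sqrt fun z hz => (huv.pos_v z hz).ne').inv
    fun z hz => (Real.sqrt_pos.2 (huv.pos_v z hz)).ne'
  have hmaps : MapsTo Prod.snd O U := fun z hz => hU hz.2
  have hAs : ContDiffOn ℝ ∞ (fun z : Param × Plane => A z.2) O :=
    hAB.smooth_A.comp contDiffOn_snd hmaps
  have hBs : ContDiffOn ℝ ∞ (fun z : Param × Plane => B z.2) O :=
    hAB.smooth_B.comp contDiffOn_snd hmaps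
  have hA0 : ∀ z ∈ O, A z.2 ≠ 0 := fun z hz => hAB.ne_A _ (hmaps hz)
  have hB0 : ∀ z ∈ O, B z.2 ≠ 0 := fun z hz => hAB.ne_B _ (hmaps hz)
  let α : Param × Plane → ℝ := fun z => -a z ^ 3 / 2 * w z
  let β : Param × Plane → ℝ := fun z => -b z ^ 3 / 2 * w' z
  have hda : ∀ z ∈ O, HasFrameDeriv (θ₁ z.2) (θ₂ z.2) (fun q => a (z.1, q)) (α z)
      ((K₁ z.2 - 1) * a z) z.2 := fun z hz => by
    refine (HasFrameDeriv.comp_deriv (hinvsqrt (huv.pos_u z hz))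
      (huv.deriv_u z.1 hz.1 z.2 hz.2)).congr_coeff rfl ?_
    linear_combination (K₁ z.2 - 1) * a z * hau z hz
  have hdb : ∀ z ∈ O, HasFrameDeriv (θ₁ z.2) (θ₂ z.2) (fun q => b (z.1, q))
      ((K₂ z.2 - 1) * b z) (β z) z.2 := fun z hz => by
    refine (HasFrameDeriv.comp_deriv (hinvsqrt (huv.pos_v z hz))
      (huv.deriv_v z.1 hz.1 z.2 hz.2)).congr_coeff ?_ rfl
    linear_combination (K₂ z.2 - 1) * b z * hbv z hz
  choose! A₁ hA₁ using hAB.deriv_A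
  choose! B₂ hB₂ using hAB.deriv_B
  have hp : p ∈ U := hU (mem_ball_self hr)
  have hOn : O ∈ 𝓝 (t₀, p) :=
    (isOpen_ball.prod isOpen_ball).mem_nhds ⟨mem_ball_self hr, mem_ball_self hr⟩
  have hd₁ := fun z (hz : z ∈ O) (i j : Fin 4) => HasFrameDeriv.connection₁
    ((hda z hz).div (hdb z hz) (hb0 z hz)) (hda z hz)
    ((hda z hz).div (hA₁ z.2 (hmaps hz)) (hA0 z hz)) i j
  have hd₂ := fun z (hz : z ∈ O) (i j : Fin 4) => HasFrameDeriv.connection₂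
    ((hdb z hz).div (hda z hz) (ha0 z hz)) (hdb z hz)
    ((hdb z hz).div (hB₂ z.2 (hmaps hz)) (hB0 z hz)) i j
  obtain ⟨ε, hε, hsub, Φ, hΦ, hΦ1, hΦ'⟩ := exists_fundamental_matrix hθ hp hOn
    (contDiffOn_connection₁ (has.div hbs hb0) has (has.div hAs hA0))
    (contDiffOn_connection₂ (hbs.div has ha0) hbs (hbs.div hBs hB0)) hd₁ hd₂ (fun z hz => by
      -- What remains is the Gauss equation for `a = u^(-1/2)`, `b = v^(-1/2)`: it is `w + w' = 2 (u
      -- + v + 1)` times `-a³ b³ / 2`, simplified with `a² u = b² v = 1`.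
      refine connection_flat (ha0 z hz) (hb0 z hz) (hA0 z hz) (hB0 z hz) ?_
      have h1 := hau z hz
      have h2 := hbv z hz
      have h3 := huv.gauss z hz
      linear_combination (-a z ^ 3 * b z ^ 3 / 2) * h3 - a z * b z ^ 3 * h1 -
        a z ^ 3 * b z * h2)
  have hsubt : ball t₀ ε ⊆ ball t₀ r := fun t ht =>
    (hsub (mk_mem_prod ht (mem_ball_self hε))).1.1
  have hsubq : ball p ε ⊆ ball p r := fun q hq =>
    (hsub (mk_mem_prod (mem_ball_self hε) hq)).1.2
  refine ⟨ε, hε, hsubt, hsubq, frameRow Φ, fun i => ?_, fun t ht q hq => ⟨?_, ?_, ?_⟩⟩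
  · exact contDiffOn_euclidean.2 fun k => hΦ i k.castSucc
  · exact orthonormal_frameRow hε (hΦ1 t) (hΦ' t ht) hq
  · refine (hasFDerivAt_frameRow (hΦ' t ht q hq) 3).congr_fderiv ?_
    simp [Fin.sum_univ_four, connection₁, connection₂, a, b]
  · refine (hasFDerivAt_frameRow (hΦ' t ht q hq) 2).congr_fderiv ?_
    simp [Fin.sum_univ_four, connection₁, connection₂, a, b]

end MovingFrames

/-! ### Immersions of a disk and their noncongruence. -/

noncomputable section PlaneRealization

open Set Filter Topology Metric

lemma IsCoframing.exists_dual₁ {U : Set Plane} {θ₁ θ₂ : Plane → Plane →L[ℝ] ℝ}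
    {K₁ K₂ : Plane → ℝ} (h : IsCoframing U θ₁ θ₂ K₁ K₂) {q : Plane} (hq : q ∈ U) :
    ∃ v, θ₁ q v = 1 ∧ θ₂ q v = 0 := by
  let L : Plane →ₗ[ℝ] Fin 2 → ℝ := LinearMap.pi ![(θ₁ q).toLinearMap, (θ₂ q).toLinearMap]
  have hinj : Function.Injective L := (injective_iff_map_eq_zero L).2 fun v hv =>
    h.injective q hq v (congrFun hv 0) (congrFun hv 1)
  obtain ⟨v, hv⟩ := (LinearMap.injective_iff_surjective_of_finrank_eq_finrank
    (by simp : Module.finrank ℝ Plane = Module.finrank ℝ (Fin 2 → ℝ))).1 hinj ![1, 0]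
  exact ⟨v, congrFun hv 0, congrFun hv 1⟩

/-- This recovers `w` from the germ of `u`, once congruence has shown that two parameters share the
same `u`. -/
lemma HasFrameDeriv.coeff_unique {U : Set Plane} {θ₁ θ₂ : Plane → Plane →L[ℝ] ℝ}
    {K₁ K₂ : Plane → ℝ} (h : IsCoframing U θ₁ θ₂ K₁ K₂) {q : Plane} (hq : q ∈ U)
    {f g : Plane → ℝ} {a b a' b' : ℝ} (hf : HasFrameDeriv (θ₁ q) (θ₂ q) f a b q)
    (hg : HasFrameDeriv (θ₁ q) (θ₂ q) g a' b' q) (hfg : f =ᶠ[𝓝 q] g) : a = a' := by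
  obtain ⟨v, h1, h2⟩ := h.exists_dual₁ hq
  have h3 := congrArg (fun f => f v) (HasFDerivAt.unique hf (hg.congr_of_eventuallyEq hfg))
  simpa [h1, h2] using h3

lemma inner_frame {e : Fin 3 → Space} (he : Orthonormal ℝ e) {x y : Space} (hx : e 0 = x)
    (hy : e 1 = y) (a b c d : ℝ) : ⟪a • x + b • y, c • x + d • y⟫_ℝ = a * c + b * d := by
  subst hx hy
  have h00 : ⟪e 0, e 0⟫_ℝ = 1 := by rw [orthonormal_iff_ite.1 he, if_pos rfl]
  have h11 : ⟪e 1, e 1⟫_ℝ = 1 := by rw [orthonormal_iff_ite.1 he, if_pos rfl]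
  have h01 : ⟪e 0, e 1⟫_ℝ = 0 := by simp [orthonormal_iff_ite.1 he]
  have h10 : ⟪e 1, e 0⟫_ℝ = 0 := by simp [orthonormal_iff_ite.1 he]
  simp only [inner_add_left, inner_add_right, real_inner_smul_left, real_inner_smul_right, h00,
    h11, h01, h10]
  ring

/-- Congruent maps into space induce the same first fundamental form. -/
lemma inner_eq_of_isometry {f g : Plane → Space} {f' g' : Plane →L[ℝ] Space} {q : Plane}
    (hf : HasFDerivAt f f' q) (hg : HasFDerivAt g g' q) (F : Space ≃ᵢ Space)
    (h : ∀ᶠ x in 𝓝 q, g x = F (f x)) (v w : Plane) : ⟪g' v, g' w⟫_ℝ = ⟪f' v, f' w⟫_ℝ := by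
  -- By the Mazur–Ulam theorem `F` is affine, so its linear part, a linear isometry, relates the two
  -- differentials.
  let L := F.toRealAffineIsometryEquiv
  have h1 : ∀ x, F x = L.linearIsometryEquiv x + F 0 := fun x => by
    have := L.toAffineEquiv.map_vadd (0 : Space) x
    simpa [L] using this
  have h2 : HasFDerivAt (fun x => L.linearIsometryEquiv (f x) + F 0)
      ((L.linearIsometryEquiv : Space →L[ℝ] Space).comp f') q :=
    ((L.linearIsometryEquiv : Space →L[ℝ] Space).hasFDerivAt.comp q hf).add_const _
  have h3 : g =ᶠ[𝓝 q] fun x => L.linearIsometryEquiv (f x) + F 0 := by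
    filter_upwards [h] with x hx
    rw [hx, h1]
  have h4 := hg.unique (h2.congr_of_eventuallyEq h3)
  rw [h4]
  exact L.linearIsometryEquiv.inner_map_map _ _

/-- The realization of `S` by a three-parameter family of mutually noncongruent immersions of an
open disk in the plane. -/
theorem exists_plane_family {U : Set Plane} {θ₁ θ₂ : Plane → Plane →L[ℝ] ℝ}
    {K₁ K₂ A B : Plane → ℝ} (hθ : IsCoframing U θ₁ θ₂ K₁ K₂) (hAB : IsAdapted U θ₁ θ₂ A B)
    {S : Plane → Plane →L[ℝ] Plane} (hS₁ : ∀ q ∈ U, ∀ v, θ₁ q (S q v) = A q * θ₁ q v)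
    (hS₂ : ∀ q ∈ U, ∀ v, θ₂ q (S q v) = B q * θ₂ q v)
    {p : Plane} {t₀ : Param} {r : ℝ} (hr : 0 < r) (hU : ball p r ⊆ U)
    {u v w w' : Param × Plane → ℝ} (huv : IsPotentialFamily θ₁ θ₂ K₁ K₂ p t₀ r u v w w') :
    ∃ ε > 0, ball p ε ⊆ U ∧ ∃ X n : Param × Plane → Space,
      ContDiffOn ℝ ∞ X (ball t₀ ε ×ˢ ball p ε) ∧ ContDiffOn ℝ ∞ n (ball t₀ ε ×ˢ ball p ε) ∧
      (∀ t ∈ ball t₀ ε, ∀ q ∈ ball p ε, ∃ X' n' : Plane →L[ℝ] Space,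
        HasFDerivAt (fun q => X (t, q)) X' q ∧ HasFDerivAt (fun q => n (t, q)) n' q ∧
        Function.Injective X' ∧ ‖n (t, q)‖ = 1 ∧ (∀ v, ⟪n (t, q), X' v⟫_ℝ = 0) ∧
        ∀ v w, -⟪n' v, X' w⟫_ℝ = ⟪X' v, X' (S q w)⟫_ℝ ∧
          ⟪X' v, X' (S q w)⟫_ℝ = ⟪X' (S q v), X' w⟫_ℝ) ∧
      ∀ s ∈ ball t₀ ε, ∀ t ∈ ball t₀ ε, s ≠ t →
        ¬ ∃ F : Space ≃ᵢ Space, ∀ q ∈ ball p ε, X (t, q) = F (X (s, q)) := by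
  obtain ⟨ε, hε, hst, hsq, E, hE, hE'⟩ := exists_adapted_frame hθ hAB hr hU huv
  have hX' : ∀ (t : Param) (q x : Plane), ((θ₁ q).smulRight (((√(u (t, q)))⁻¹ / A q) • E 0 (t, q)) +
      (θ₂ q).smulRight (((√(v (t, q)))⁻¹ / B q) • E 1 (t, q))) x =
      (θ₁ q x * ((√(u (t, q)))⁻¹ / A q)) • E 0 (t, q) +
        (θ₂ q x * ((√(v (t, q)))⁻¹ / B q)) • E 1 (t, q) := fun t q x => by
    simp [smul_smul]
  have hn' : ∀ (t : Param) (q x : Plane), ((θ₁ q).smulRight (-(√(u (t, q)))⁻¹ • E 0 (t, q)) +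
      (θ₂ q).smulRight (-(√(v (t, q)))⁻¹ • E 1 (t, q))) x =
      (θ₁ q x * -(√(u (t, q)))⁻¹) • E 0 (t, q) +
        (θ₂ q x * -(√(v (t, q)))⁻¹) • E 1 (t, q) := fun t q x => by
    simp [smul_smul]
  refine ⟨ε, hε, hsq.trans hU, E 3, E 2, hE 3, hE 2, fun t ht q hq => ?_, ?_⟩
  · obtain ⟨ho, hX, hn⟩ := hE' t ht q hq
    have hz : (t, q) ∈ ball t₀ r ×ˢ ball p r := ⟨hst ht, hsq hq⟩
    have hqU : q ∈ U := hU (hsq hq)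
    have hin : ∀ a b c d : ℝ, ⟪a • E 0 (t, q) + b • E 1 (t, q),
        c • E 0 (t, q) + d • E 1 (t, q)⟫_ℝ = a * c + b * d := inner_frame ho rfl rfl
    have hu : (√(u (t, q)))⁻¹ ≠ 0 := inv_ne_zero (Real.sqrt_pos.2 (huv.pos_u _ hz)).ne'
    have hv : (√(v (t, q)))⁻¹ ≠ 0 := inv_ne_zero (Real.sqrt_pos.2 (huv.pos_v _ hz)).ne'
    have hA := hAB.ne_A q hqU
    have hB := hAB.ne_B q hqU
    refine ⟨_, _, hX, hn, ?_, ho.norm_eq_one 2, fun x => ?_, fun x y => ?_⟩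
    · refine (injective_iff_map_eq_zero _).2 fun x hx => ?_
      rw [hX'] at hx
      have h1 := hin (θ₁ q x * ((√(u (t, q)))⁻¹ / A q)) (θ₂ q x * ((√(v (t, q)))⁻¹ / B q)) 1 0
      have h2 := hin (θ₁ q x * ((√(u (t, q)))⁻¹ / A q)) (θ₂ q x * ((√(v (t, q)))⁻¹ / B q)) 0 1
      rw [hx, inner_zero_left] at h1 h2
      refine hθ.injective q hqU x ?_ ?_
      · have h3 : θ₁ q x * ((√(u (t, q)))⁻¹ / A q) = 0 := by linarith
        exact (mul_eq_zero.1 h3).resolve_right (div_ne_zero hu hA)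
      · have h3 : θ₂ q x * ((√(v (t, q)))⁻¹ / B q) = 0 := by linarith
        exact (mul_eq_zero.1 h3).resolve_right (div_ne_zero hv hB)
    · have h20 : ⟪E 2 (t, q), E 0 (t, q)⟫_ℝ = 0 := ho.2 (by decide : (2 : Fin 3) ≠ 0)
      have h21 : ⟪E 2 (t, q), E 1 (t, q)⟫_ℝ = 0 := ho.2 (by decide : (2 : Fin 3) ≠ 1)
      rw [hX', inner_add_right, real_inner_smul_right, real_inner_smul_right, h20, h21]
      ring
    · rw [hX', hX', hX', hX', hn', hin, hin, hin, hS₁ q hqU, hS₂ q hqU, hS₁ q hqU, hS₂ q hqU]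
      constructor
      · field_simp
        ring
      · ring
  · rintro s hs t ht hne ⟨F, hF⟩
    -- Evaluated on the dual frame vectors `x` and `y`, the first fundamental form is `1 / (u A²)`
    -- and `1 / (v B²)`, and `A`, `B` do not depend on the parameter.
    have hfirst : ∀ q ∈ ball p ε, u (s, q) = u (t, q) ∧ v (s, q) = v (t, q) := fun q hq => by
      obtain ⟨hos, hXs, -⟩ := hE' s hs q hq
      obtain ⟨hot, hXt, -⟩ := hE' t ht q hq
      have hqU : q ∈ U := hU (hsq hq)
      have hA := hAB.ne_A q hqU
      have hB := hAB.ne_B q hqU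
      have hzs : (s, q) ∈ ball t₀ r ×ˢ ball p r := ⟨hst hs, hsq hq⟩
      have hzt : (t, q) ∈ ball t₀ r ×ˢ ball p r := ⟨hst ht, hsq hq⟩
      have h0 : ∀ᶠ x in 𝓝 q, E 3 (t, x) = F (E 3 (s, x)) := by
        filter_upwards [isOpen_ball.mem_nhds hq] with x hx using hF x hx
      have h1 := fun x => inner_eq_of_isometry hXs hXt F h0 x x
      have hins : ∀ a b c d : ℝ, ⟪a • E 0 (s, q) + b • E 1 (s, q),
        c • E 0 (s, q) + d • E 1 (s, q)⟫_ℝ = a * c + b * d := inner_frame hos rfl rfl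
      have hint : ∀ a b c d : ℝ, ⟪a • E 0 (t, q) + b • E 1 (t, q),
        c • E 0 (t, q) + d • E 1 (t, q)⟫_ℝ = a * c + b * d := inner_frame hot rfl rfl
      obtain ⟨x, hx1, hx2⟩ := hθ.exists_dual₁ hqU
      obtain ⟨y, hy2, hy1⟩ := hθ.swap.exists_dual₁ hqU
      have hsol : ∀ {a b c : ℝ}, 0 < a → 0 < b → c ≠ 0 →
          (√b)⁻¹ / c * ((√b)⁻¹ / c) = (√a)⁻¹ / c * ((√a)⁻¹ / c) → a = b := by
        intro a b c ha hb hc h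
        have h2 : ∀ {d : ℝ}, 0 < d → (√d)⁻¹ / c * ((√d)⁻¹ / c) = d⁻¹ / c ^ 2 := fun {d} hd => by
          rw [div_mul_div_comm, ← mul_inv, Real.mul_self_sqrt hd.le, sq]
        rw [h2 ha, h2 hb] at h
        have h3 := (div_left_inj' (pow_ne_zero 2 hc)).1 h
        exact inv_injective h3.symm
      have hx := h1 x
      have hy := h1 y
      simp only [hX', hins, hint, hx1, hx2] at hx
      simp only [hX', hins, hint, hy1, hy2] at hy
      simp only [zero_mul, one_mul, mul_zero, add_zero, zero_add] at hx hy
      exact ⟨hsol (huv.pos_u _ hzs) (huv.pos_u _ hzt) hA hx,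
        hsol (huv.pos_v _ hzs) (huv.pos_v _ hzt) hB hy⟩
    have hp : p ∈ ball p ε := mem_ball_self hε
    refine hne (huv.separates s t (hfirst p hp).1 (hfirst p hp).2 ?_)
    refine HasFrameDeriv.coeff_unique hθ (hU (hsq hp)) (huv.deriv_u s (hst hs) p (hsq hp))
      (huv.deriv_u t (hst ht) p (hsq hp)) ?_
    filter_upwards [isOpen_ball.mem_nhds hp] with q hq using (hfirst q hq).1

end PlaneRealization

/-! ### Eigenvalues and the associated coframing of an endomorphism field of the plane. -/

noncomputable section PlaneShape

open Set Filter Topology Metric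

/-- The trace of an endomorphism of the plane. -/
def planeTrace (L : Plane →L[ℝ] Plane) : ℝ :=
  L (EuclideanSpace.single 0 1) 0 + L (EuclideanSpace.single 1 1) 1

/-- The determinant of an endomorphism of the plane. -/
def planeDet (L : Plane →L[ℝ] Plane) : ℝ :=
  L (EuclideanSpace.single 0 1) 0 * L (EuclideanSpace.single 1 1) 1 -
    L (EuclideanSpace.single 1 1) 0 * L (EuclideanSpace.single 0 1) 1

lemma plane_decomp (v : Plane) :
    v = v 0 • EuclideanSpace.single 0 (1 : ℝ) + v 1 • EuclideanSpace.single 1 (1 : ℝ) := by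
  ext i
  fin_cases i <;> simp

lemma plane_apply (L : Plane →L[ℝ] Plane) (v : Plane) (i : Fin 2) :
    L v i = v 0 * L (EuclideanSpace.single 0 1) i + v 1 * L (EuclideanSpace.single 1 1) i := by
  conv_lhs => rw [plane_decomp v]
  simp

/-- The adjugate of `A - L` applied to `(A - L) v = 0` shows that the characteristic polynomial at
`A` annihilates both coordinates of the eigenvector `v`. -/
lemma eigen_root {L : Plane →L[ℝ] Plane} {A : ℝ} (h : Module.End.HasEigenvalue L.toLinearMap A) :
    A ^ 2 - planeTrace L * A + planeDet L = 0 := by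
  obtain ⟨v, hv⟩ := h.exists_hasEigenvector
  have h1 : L v = A • v := hv.apply_eq_smul
  have h0 := congrArg (fun x : Plane => x 0) h1
  have h2 := congrArg (fun x : Plane => x 1) h1
  simp only [plane_apply L v, PiLp.smul_apply, smul_eq_mul] at h0 h2
  have e0 : (A ^ 2 - planeTrace L * A + planeDet L) * v 0 = 0 := by
    unfold planeTrace planeDet
    linear_combination (-(A - L (EuclideanSpace.single 1 1) 1)) * h0 -
      L (EuclideanSpace.single 1 1) 0 * h2
  have e1 : (A ^ 2 - planeTrace L * A + planeDet L) * v 1 = 0 := by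
    unfold planeTrace planeDet
    linear_combination (-(A - L (EuclideanSpace.single 0 1) 0)) * h2 -
      L (EuclideanSpace.single 0 1) 1 * h0
  by_contra hne
  refine hv.2 ?_
  ext i
  fin_cases i
  · exact (mul_eq_zero.1 e0).resolve_left hne
  · exact (mul_eq_zero.1 e1).resolve_left hne

lemma plane_cayley_hamilton (L : Plane →L[ℝ] Plane) (v : Plane) :
    L (L v) = planeTrace L • L v - planeDet L • v := by
  ext i
  rw [plane_apply L (L v)]
  simp only [PiLp.sub_apply, PiLp.smul_apply, smul_eq_mul, plane_apply L v]
  unfold planeTrace planeDet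
  fin_cases i <;> simp <;> ring

section Pointwise

variable {L : Plane →L[ℝ] Plane} {A B : ℝ}

lemma trace_det_of_eigen (hlt : B < A) (hA : Module.End.HasEigenvalue L.toLinearMap A)
    (hB : Module.End.HasEigenvalue L.toLinearMap B) :
    planeTrace L = A + B ∧ planeDet L = A * B := by
  have h1 := eigen_root hA
  have h2 := eigen_root hB
  have h3 : (A - B) * (A + B - planeTrace L) = 0 := by linear_combination h1 - h2
  have h4 := (mul_eq_zero.1 h3).resolve_left (sub_pos.2 hlt).ne'
  constructor
  · linarith
  · linear_combination h1 - A * h4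

lemma eigen_formula (hlt : B < A) (hA : Module.End.HasEigenvalue L.toLinearMap A)
    (hB : Module.End.HasEigenvalue L.toLinearMap B) :
    A = (planeTrace L + √(planeTrace L ^ 2 - 4 * planeDet L)) / 2 ∧
      B = (planeTrace L - √(planeTrace L ^ 2 - 4 * planeDet L)) / 2 := by
  obtain ⟨h1, h2⟩ := trace_det_of_eigen hlt hA hB
  have h3 : planeTrace L ^ 2 - 4 * planeDet L = (A - B) ^ 2 := by rw [h1, h2]; ring
  rw [h3, Real.sqrt_sq (sub_pos.2 hlt).le, h1]
  constructor <;> ring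

/-- If the first components of two covectors do not vanish on the eigenlines, these eigenlines
are spanned by vectors on which the covectors do not vanish. -/
lemma exists_eigenbasis (hlt : B < A) (hA : Module.End.HasEigenvalue L.toLinearMap A)
    (hB : Module.End.HasEigenvalue L.toLinearMap B) {φ ψ : Plane →L[ℝ] ℝ}
    (hφ : ∃ v, φ (L v - A • v) ≠ 0) (hψ : ∃ v, ψ (L v - B • v) ≠ 0) :
    ∃ x z : Plane, L x = A • x ∧ L z = B • z ∧ ψ x ≠ 0 ∧ φ z ≠ 0 ∧
      ∀ v, ∃ a b : ℝ, v = a • x + b • z := by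
  obtain ⟨v, hv⟩ := hφ
  obtain ⟨w, hw⟩ := hψ
  obtain ⟨h1, h2⟩ := trace_det_of_eigen hlt hA hB
  -- By Cayley–Hamilton `(L - A)(L - B) = 0`, so the image of `L - B` lies in the `A`-eigenspace,
  -- and conversely.
  have hx : L (L w - B • w) = A • (L w - B • w) := by
    rw [map_sub, map_smul, plane_cayley_hamilton, h1, h2]
    module
  have hz : L (L v - A • v) = B • (L v - A • v) := by
    rw [map_sub, map_smul, plane_cayley_hamilton, h1, h2]
    module
  refine ⟨L w - B • w, L v - A • v, hx, hz, hw, hv, fun u => ?_⟩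
  set x := L w - B • w
  set z := L v - A • v
  have hx0 : x ≠ 0 := fun h => hw (by rw [h, map_zero])
  have hz0 : z ≠ 0 := fun h => hv (by rw [h, map_zero])
  have hind : LinearIndependent ℝ ![x, z] := by
    rw [LinearIndependent.pair_iff]
    intro s t hst
    have h3 : L (s • x + t • z) = 0 := by rw [hst, map_zero]
    rw [map_add, map_smul, map_smul, hx, hz] at h3
    have h4 : (s * (A - B)) • x = 0 := by
      have : (s * (A - B)) • x = s • A • x + t • B • z - B • (s • x + t • z) := by module
      rw [this, h3, hst, smul_zero, sub_zero]
    have h5 : (t * (B - A)) • z = 0 := by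
      have : (t * (B - A)) • z = s • A • x + t • B • z - A • (s • x + t • z) := by module
      rw [this, h3, hst, smul_zero, sub_zero]
    have hAB : A - B ≠ 0 := (sub_pos.2 hlt).ne'
    have hBA : B - A ≠ 0 := (sub_neg.2 hlt).ne
    exact ⟨(mul_eq_zero.1 ((smul_eq_zero.1 h4).resolve_right hx0)).resolve_right hAB,
      (mul_eq_zero.1 ((smul_eq_zero.1 h5).resolve_right hz0)).resolve_right hBA⟩
  have hspan := hind.span_eq_top_of_card_eq_finrank (by simp)
  have hu : u ∈ Submodule.span ℝ (range ![x, z]) := by rw [hspan]; trivial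
  rw [Matrix.range_cons, Matrix.range_cons, Matrix.range_empty, union_empty, singleton_union,
    Submodule.mem_span_pair] at hu
  obtain ⟨a, b, hab⟩ := hu
  exact ⟨a, b, hab.symm⟩

end Pointwise

/-- The eigenvalues of a smooth endomorphism field of the plane are smooth where they are
distinct. -/
theorem contDiffOn_eigenvalues {U : Set Plane} {S : Plane → Plane →L[ℝ] Plane}
    (hS : ContDiffOn ℝ ∞ S U) {A B : Plane → ℝ} (hlt : ∀ q ∈ U, B q < A q)
    (hA : ∀ q ∈ U, Module.End.HasEigenvalue (S q).toLinearMap (A q))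
    (hB : ∀ q ∈ U, Module.End.HasEigenvalue (S q).toLinearMap (B q)) :
    ContDiffOn ℝ ∞ A U ∧ ContDiffOn ℝ ∞ B U := by
  have hent : ∀ i j : Fin 2, ContDiffOn ℝ ∞ (fun q => S q (EuclideanSpace.single i 1) j) U :=
    fun i j => contDiffOn_euclidean.1 (hS.clm_apply contDiffOn_const) j
  have htr : ContDiffOn ℝ ∞ (fun q => planeTrace (S q)) U := (hent 0 0).add (hent 1 1)
  have hdet : ContDiffOn ℝ ∞ (fun q => planeDet (S q)) U :=
    ((hent 0 0).mul (hent 1 1)).sub ((hent 1 0).mul (hent 0 1))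
  have hdisc : ContDiffOn ℝ ∞
      (fun q => √(planeTrace (S q) ^ 2 - 4 * planeDet (S q))) U := by
    refine ((htr.pow 2).sub (contDiffOn_const.mul hdet)).sqrt fun q hq => ?_
    obtain ⟨h1, h2⟩ := trace_det_of_eigen (hlt q hq) (hA q hq) (hB q hq)
    have h3 : planeTrace (S q) ^ 2 - 4 * planeDet (S q) = (A q - B q) ^ 2 := by
      rw [h1, h2]
      ring
    rw [h3]
    exact pow_ne_zero 2 (sub_pos.2 (hlt q hq)).ne'
  refine ⟨((htr.add hdisc).div_const 2).congr fun q hq =>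
    (eigen_formula (hlt q hq) (hA q hq) (hB q hq)).1, ?_⟩
  exact ((htr.sub hdisc).div_const 2).congr fun q hq =>
    (eigen_formula (hlt q hq) (hA q hq) (hB q hq)).2

/-- The associated coframing of a nondegenerate invertible endomorphism field of the plane. -/
theorem adapted_of_shape {U : Set Plane} (hU : IsOpen U) {S : Plane → Plane →L[ℝ] Plane}
    (hS : ContDiffOn ℝ ∞ S U) {A B : Plane → ℝ} (hlt : ∀ q ∈ U, B q < A q)
    (hA : ∀ q ∈ U, Module.End.HasEigenvalue (S q).toLinearMap (A q))
    (hB : ∀ q ∈ U, Module.End.HasEigenvalue (S q).toLinearMap (B q))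
    (hA0 : ∀ q ∈ U, A q ≠ 0) (hB0 : ∀ q ∈ U, B q ≠ 0)
    (hnA : ∀ q ∈ U, ∃ v, fderiv ℝ A q (S q v - A q • v) ≠ 0)
    (hnB : ∀ q ∈ U, ∃ v, fderiv ℝ B q (S q v - B q • v) ≠ 0)
    {θ₁ θ₂ : Plane → Plane →L[ℝ] ℝ}
    (hθ₁ : ∀ q ∈ U, ∀ v, θ₁ q v = A q / (B q * (B q - A q)) *
      ((A q - B q)⁻¹ * fderiv ℝ B q (S q v - B q • v)))
    (hθ₂ : ∀ q ∈ U, ∀ v, θ₂ q v = B q / (A q * (A q - B q)) *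
      ((B q - A q)⁻¹ * fderiv ℝ A q (S q v - A q • v))) :
    IsAdapted U θ₁ θ₂ A B ∧ ContDiffOn ℝ ∞ θ₁ U ∧ ContDiffOn ℝ ∞ θ₂ U ∧
      (∀ q ∈ U, ∀ v, θ₁ q v = 0 → θ₂ q v = 0 → v = 0) ∧
      (∀ q ∈ U, ∀ v, θ₁ q (S q v) = A q * θ₁ q v) ∧
      ∀ q ∈ U, ∀ v, θ₂ q (S q v) = B q * θ₂ q v := by
  obtain ⟨hAs, hBs⟩ := contDiffOn_eigenvalues hS hlt hA hB
  have hAB : ∀ q ∈ U, A q - B q ≠ 0 := fun q hq => (sub_pos.2 (hlt q hq)).ne'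
  have hBA : ∀ q ∈ U, B q - A q ≠ 0 := fun q hq => (sub_neg.2 (hlt q hq)).ne
  have hdA : ContDiffOn ℝ ∞ (fderiv ℝ A) U := hAs.fderiv_of_isOpen hU (by simp)
  have hdB : ContDiffOn ℝ ∞ (fderiv ℝ B) U := hBs.fderiv_of_isOpen hU (by simp)
  have hbasis := fun q hq => exists_eigenbasis (hlt q hq) (hA q hq) (hB q hq) (hnA q hq)
    (hnB q hq)
  -- In an eigenbasis `θ₁` sees only the `A`-component and `θ₂` only the `B`-component; all the
  -- assertions below follow from this.
  have hval : ∀ q ∈ U, ∀ x z : Plane, S q x = A q • x → S q z = B q • z → ∀ a b : ℝ,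
      θ₁ q (a • x + b • z) = a * (A q / (B q * (B q - A q)) * fderiv ℝ B q x) ∧
      θ₂ q (a • x + b • z) = b * (B q / (A q * (A q - B q)) * fderiv ℝ A q z) := by
    intro q hq x z hx hz a b
    have h1 : S q (a • x + b • z) - B q • (a • x + b • z) = (a * (A q - B q)) • x := by
      rw [map_add, map_smul, map_smul, hx, hz]
      module
    have h2 : S q (a • x + b • z) - A q • (a • x + b • z) = (b * (B q - A q)) • z := by
      rw [map_add, map_smul, map_smul, hx, hz]
      module
    rw [hθ₁ q hq, hθ₂ q hq, h1, h2, map_smul, map_smul, smul_eq_mul, smul_eq_mul]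
    have h3 := hAB q hq
    have h4 := hBA q hq
    have h5 := hA0 q hq
    have h6 := hB0 q hq
    constructor <;> field_simp
  refine ⟨⟨hAs, hBs, hA0, hB0, fun q hq => ?_, fun q hq => ?_⟩, ?_, ?_, fun q hq v h1 h2 => ?_,
    fun q hq v => ?_, fun q hq v => ?_⟩
  · obtain ⟨x, z, hx, hz, hψ, hφ, hdec⟩ := hbasis q hq
    -- The unprescribed coefficient is `dA(x) / θ₁(x)`; nondegeneracy makes the denominator nonzero.
    refine ⟨fderiv ℝ A q x / (A q / (B q * (B q - A q)) * fderiv ℝ B q x), ?_⟩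
    have hd : HasFDerivAt A (fderiv ℝ A q) q :=
      ((hAs.contDiffAt (hU.mem_nhds hq)).differentiableAt (by simp)).hasFDerivAt
    refine HasFDerivAt.congr_fderiv hd ?_
    ext v
    obtain ⟨a, b, rfl⟩ := hdec v
    obtain ⟨e1, e2⟩ := hval q hq x z hx hz a b
    rw [_root_.add_apply, _root_.smul_apply, _root_.smul_apply, e1, e2, map_add, map_smul,
      map_smul, smul_eq_mul, smul_eq_mul, smul_eq_mul, smul_eq_mul]
    have h3 := hAB q hq
    have h4 := hBA q hq
    have h5 := hA0 q hq
    have h6 := hB0 q hq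
    field_simp
  · obtain ⟨x, z, hx, hz, hψ, hφ, hdec⟩ := hbasis q hq
    refine ⟨fderiv ℝ B q z / (B q / (A q * (A q - B q)) * fderiv ℝ A q z), ?_⟩
    have hd : HasFDerivAt B (fderiv ℝ B q) q :=
      ((hBs.contDiffAt (hU.mem_nhds hq)).differentiableAt (by simp)).hasFDerivAt
    refine HasFDerivAt.congr_fderiv hd ?_
    ext v
    obtain ⟨a, b, rfl⟩ := hdec v
    obtain ⟨e1, e2⟩ := hval q hq x z hx hz a b
    rw [_root_.add_apply, _root_.smul_apply, _root_.smul_apply, e1, e2, map_add, map_smul,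
      map_smul, smul_eq_mul, smul_eq_mul, smul_eq_mul, smul_eq_mul]
    have h3 := hAB q hq
    have h4 := hBA q hq
    have h5 := hA0 q hq
    have h6 := hB0 q hq
    field_simp
  · have h : ContDiffOn ℝ ∞ (fun q => (A q / (B q * (B q - A q))) • ((A q - B q)⁻¹ •
        (fderiv ℝ B q).comp (S q - B q • ContinuousLinearMap.id ℝ Plane))) U :=
      (hAs.div (hBs.mul (hBs.sub hAs)) fun q hq => mul_ne_zero (hB0 q hq) (hBA q hq)).smul
        (((hAs.sub hBs).inv hAB).smul (hdB.clm_comp (hS.sub (hBs.smul contDiffOn_const))))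
    refine h.congr fun q hq => ?_
    ext v
    rw [hθ₁ q hq]
    simp
  · have h : ContDiffOn ℝ ∞ (fun q => (B q / (A q * (A q - B q))) • ((B q - A q)⁻¹ •
        (fderiv ℝ A q).comp (S q - A q • ContinuousLinearMap.id ℝ Plane))) U :=
      (hBs.div (hAs.mul (hAs.sub hBs)) fun q hq => mul_ne_zero (hA0 q hq) (hAB q hq)).smul
        (((hBs.sub hAs).inv hBA).smul (hdA.clm_comp (hS.sub (hAs.smul contDiffOn_const))))
    refine h.congr fun q hq => ?_
    ext v
    rw [hθ₂ q hq]
    simp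
  · obtain ⟨x, z, hx, hz, hψ, hφ, hdec⟩ := hbasis q hq
    obtain ⟨a, b, rfl⟩ := hdec v
    obtain ⟨e1, e2⟩ := hval q hq x z hx hz a b
    rw [e1] at h1
    rw [e2] at h2
    have ha : a = 0 := (mul_eq_zero.1 h1).resolve_right (mul_ne_zero (div_ne_zero (hA0 q hq)
      (mul_ne_zero (hB0 q hq) (hBA q hq))) hψ)
    have hb : b = 0 := (mul_eq_zero.1 h2).resolve_right (mul_ne_zero (div_ne_zero (hB0 q hq)
      (mul_ne_zero (hA0 q hq) (hAB q hq))) hφ)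
    rw [ha, hb, zero_smul, zero_smul, add_zero]
  · obtain ⟨x, z, hx, hz, -, -, hdec⟩ := hbasis q hq
    obtain ⟨a, b, rfl⟩ := hdec v
    have e : S q (a • x + b • z) = (a * A q) • x + (b * B q) • z := by
      rw [map_add, map_smul, map_smul, hx, hz, smul_smul, smul_smul]
    rw [e, (hval q hq x z hx hz _ _).1, (hval q hq x z hx hz _ _).1]
    ring
  · obtain ⟨x, z, hx, hz, -, -, hdec⟩ := hbasis q hq
    obtain ⟨a, b, rfl⟩ := hdec v
    have e : S q (a • x + b • z) = (a * A q) • x + (b * B q) • z := by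
      rw [map_add, map_smul, map_smul, hx, hz, smul_smul, smul_smul]
    rw [e, (hval q hq x z hx hz _ _).2, (hval q hq x z hx hz _ _).2]
    ring

end PlaneShape

/-! ### Passage between the surface and a chart. -/

noncomputable section SurfaceTransfer

open Set Filter Topology Metric

variable {M : Type*} [TopologicalSpace M] [ChartedSpace Plane M]

/-- The differential of a chart. -/
def chartDeriv (e : OpenPartialHomeomorph M Plane) (q : M) : TangentSpace (𝓡 2) q →L[ℝ] Plane :=
  mfderiv (𝓡 2) 𝓘(ℝ, Plane) e q

/-- The differential of the inverse of a chart. -/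
def chartSymmDeriv (e : OpenPartialHomeomorph M Plane) (y : Plane) :
    Plane →L[ℝ] TangentSpace (𝓡 2) (e.symm y) :=
  mfderiv 𝓘(ℝ, Plane) (𝓡 2) e.symm y

/-- The expression of an endomorphism field in a chart. -/
def chartShape (e : OpenPartialHomeomorph M Plane) (S : ShapeField M) (y : Plane) :
    Plane →L[ℝ] Plane :=
  (chartDeriv e (e.symm y)).comp ((S (e.symm y)).comp (chartSymmDeriv e y))

/-- The expression of a 1-form in a chart, as a field of linear forms on the plane. -/
def chartCovector (e : OpenPartialHomeomorph M Plane) (φ : OneForm M) (y : Plane) :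
    Plane →L[ℝ] ℝ :=
  (φ (e.symm y)).comp (chartSymmDeriv e y)

variable {e : OpenPartialHomeomorph M Plane}

lemma fderiv_chartCovector_sub {φ : OneForm M} {Ω : TwoForm M} (h : HasExtDeriv φ Ω)
    (he : e ∈ atlas Plane M) {y : Plane} (hy : y ∈ e.target)
    (hφ : DifferentiableAt ℝ (chartCovector e φ) y) (v w : Plane) :
    fderiv ℝ (chartCovector e φ) y v w - fderiv ℝ (chartCovector e φ) y w v =
      Ω (e.symm y) (chartSymmDeriv e y v) (chartSymmDeriv e y w) := by
  have h1 := h e he y hy v w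
  have h2 : DifferentiableAt ℝ (chartForm e φ) y :=
    (ContinuousAlternatingMap.ofSubsingletonLIE (𝕜 := ℝ) (E := Plane) (F := ℝ)
      (0 : Fin 1)).toContinuousLinearEquiv.differentiableAt.comp y hφ
  have h3 (u x : Plane) : fderiv ℝ (fun z => chartCovector e φ z u) y x =
      fderiv ℝ (chartCovector e φ) y x u := by
    rw [fderiv_clm_apply hφ (differentiableAt_const u)]
    simp
  rw [extDeriv_apply h2, Fin.sum_univ_two] at h1
  -- Removing entry `0` of `![v, w]` leaves `w` and removing entry `1` leaves `v`, so the
  -- alternating sum is `D_v φ(w) - D_w φ(v)`.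
  have h4 : (fun z => chartForm e φ z ((0 : Fin 2).removeNth ![v, w])) =
      fun z => chartCovector e φ z w := rfl
  have h5 : (fun z => chartForm e φ z ((1 : Fin 2).removeNth ![v, w])) =
      fun z => chartCovector e φ z v := rfl
  rw [h4, h5, h3, h3] at h1
  refine Eq.trans ?_ h1
  simp [sub_eq_add_neg]

lemma dPrime_apply (S : ShapeField M) (A B f : M → ℝ) (q : M) (v : TangentSpace (𝓡 2) q) :
    dPrime S A B f q v = (A q - B q)⁻¹ * differential f q (S q v - B q • v) := by
  change differential f q ((A q - B q)⁻¹ • (S q v - B q • v)) = _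
  rw [map_smul, smul_eq_mul]

lemma dDoublePrime_apply (S : ShapeField M) (A B f : M → ℝ) (q : M)
    (v : TangentSpace (𝓡 2) q) :
    dDoublePrime S A B f q v = (B q - A q)⁻¹ * differential f q (S q v - A q • v) := by
  change differential f q ((B q - A q)⁻¹ • (S q v - A q • v)) = _
  rw [map_smul, smul_eq_mul]

variable [IsManifold (𝓡 2) ∞ M]

lemma chartSymmDeriv_chartDeriv (he : e ∈ atlas Plane M) {y : Plane} (hy : y ∈ e.target)
    (v : TangentSpace (𝓡 2) (e.symm y)) :
    chartSymmDeriv e y (chartDeriv e (e.symm y) v) = v := by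
  have h := (mdifferentiable_of_mem_atlas (I := 𝓡 2) he).symm.comp_symm_deriv
    (x := e.symm y) (e.map_target hy)
  simp only [OpenPartialHomeomorph.symm_symm] at h
  have h2 := congrArg
    (fun f : TangentSpace (𝓡 2) (e.symm y) →L[ℝ] TangentSpace (𝓡 2) (e.symm y) => f v) h
  rw [e.right_inv hy] at h2
  exact h2

/-- Smoothness of a section is tested in the trivialization of the endomorphism bundle at `p`. The
tangent trivialization at `p` is the differential of the preferred chart there, so this yields
exactly `chartShape`. -/
lemma contDiffOn_chartShape {S : ShapeField M} (hS : S.IsSmooth) (p : M) :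
    ContDiffOn ℝ ∞ (chartShape (chartAt Plane p) S) (chartAt Plane p).target := by
  set e := chartAt Plane p with he
  have h1 := hS.contMDiffOn (s := e.source)
  rw [(trivializationAt (Plane →L[ℝ] Plane)
    (fun q : M => TangentSpace (𝓡 2) q →L[ℝ] TangentSpace (𝓡 2) q) p).contMDiffOn_section_iff
    e.open_source (by intro q hq; simpa using hq)] at h1
  have h2 : ContMDiffOn 𝓘(ℝ, Plane) (𝓡 2) ∞ e.symm e.target := contMDiffOn_chart_symm
  have h3 := h1.comp h2 e.mapsTo_symm
  rw [contMDiffOn_iff_contDiffOn] at h3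
  refine h3.congr fun y hy => ?_
  have hq : e.symm y ∈ e.source := e.map_target hy
  have h4 := TangentBundle.continuousLinearMapAt_trivializationAt (I := 𝓡 2) (x₀ := p) hq
  have h5 := TangentBundle.symmL_trivializationAt (I := 𝓡 2) (x₀ := p) hq
  have h6 : extChartAt (𝓡 2) p (e.symm y) = y := by simp [← he, e.right_inv hy]
  rw [h6] at h5
  simp only [modelWithCornersSelf_coe, range_id,
    mfderivWithin_univ] at h5
  have h7 : ((trivializationAt (Plane →L[ℝ] Plane)
      (fun q : M => TangentSpace (𝓡 2) q →L[ℝ] TangentSpace (𝓡 2) q) p)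
        ⟨e.symm y, S (e.symm y)⟩).2 =
      ((trivializationAt Plane (TangentSpace (𝓡 2)) p).continuousLinearMapAt ℝ (e.symm y)).comp
        ((S (e.symm y)).comp
          ((trivializationAt Plane (TangentSpace (𝓡 2)) p).symmL ℝ (e.symm y))) := by
    rw [hom_trivializationAt_apply]
    rfl
  refine Eq.trans ?_ h7.symm
  rw [h4, h5]
  rfl

/-- Needed for `A` and `B`, which are not assumed differentiable: their smoothness is first obtained
in the chart from the eigenvalue formula. -/
lemma mdifferentiableAt_of_chart {f : M → ℝ} (he : e ∈ atlas Plane M)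
    (hf : ContDiffOn ℝ ∞ (fun y => f (e.symm y)) e.target) {q : M} (hq : q ∈ e.source) :
    MDifferentiableAt (𝓡 2) 𝓘(ℝ, ℝ) f q := by
  have h1 : MDifferentiableAt (𝓡 2) (𝓡 2) e q := mdifferentiableAt_atlas he hq
  have h2 : DifferentiableAt ℝ (fun y => f (e.symm y)) (e q) :=
    (hf.contDiffAt (e.open_target.mem_nhds (e.map_source hq))).differentiableAt (by simp)
  refine (h2.mdifferentiableAt.comp q h1).congr_of_eventuallyEq ?_
  filter_upwards [e.open_source.mem_nhds hq] with x hx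
  simp [e.left_inv hx]

lemma fderiv_comp_chart_symm {f : M → ℝ} (he : e ∈ atlas Plane M) {y : Plane}
    (hy : y ∈ e.target) (hf : MDifferentiableAt (𝓡 2) 𝓘(ℝ, ℝ) f (e.symm y)) (v : Plane) :
    fderiv ℝ (fun y => f (e.symm y)) y v = differential f (e.symm y) (chartSymmDeriv e y v) := by
  have h1 : MDifferentiableAt 𝓘(ℝ, Plane) (𝓡 2) e.symm y := mdifferentiableAt_atlas_symm he hy
  have h2 := mfderiv_comp y hf h1
  rw [mfderiv_eq_fderiv] at h2
  exact congrArg (fun L : Plane →L[ℝ] ℝ => L v) h2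

lemma contDiffOn_comp_chart_symm {f : M → ℝ} (hf : ContMDiff (𝓡 2) 𝓘(ℝ, ℝ) ∞ f) (p : M) :
    ContDiffOn ℝ ∞ (fun y => f ((chartAt Plane p).symm y)) (chartAt Plane p).target := by
  rw [← contMDiffOn_iff_contDiffOn]
  exact hf.comp_contMDiffOn (contMDiffOn_chart_symm (I := 𝓡 2))

lemma chartSymmDeriv_chartShape (he : e ∈ atlas Plane M) {y : Plane} (hy : y ∈ e.target)
    (S : ShapeField M) (v : Plane) :
    chartSymmDeriv e y (chartShape e S y v) = S (e.symm y) (chartSymmDeriv e y v) :=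
  chartSymmDeriv_chartDeriv he hy _

lemma hasEigenvalue_chartShape (he : e ∈ atlas Plane M) {y : Plane} (hy : y ∈ e.target)
    {S : ShapeField M} {a : ℝ}
    (h : Module.End.HasEigenvalue (S (e.symm y)).toLinearMap a) :
    Module.End.HasEigenvalue (chartShape e S y).toLinearMap a := by
  obtain ⟨v, hv⟩ := h.exists_hasEigenvector
  have h1 : S (e.symm y) v = a • v := hv.apply_eq_smul
  have h2 := chartSymmDeriv_chartDeriv he hy v
  refine Module.End.hasEigenvalue_of_hasEigenvector (x := chartDeriv e (e.symm y) v)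
    ⟨Module.End.mem_eigenspace_iff.2 ?_, fun h0 => hv.2 ?_⟩
  · change chartDeriv e (e.symm y) (S (e.symm y) (chartSymmDeriv e y _)) = _
    rw [h2, h1, map_smul]
  · rw [← h2, h0, map_zero]

lemma chart_differential_sub (he : e ∈ atlas Plane M) {y : Plane} (hy : y ∈ e.target)
    {f : M → ℝ} (hf : ContDiffOn ℝ ∞ (fun y => f (e.symm y)) e.target) (S : ShapeField M)
    (a : ℝ) (v : Plane) :
    differential f (e.symm y) (S (e.symm y) (chartSymmDeriv e y v) - a • chartSymmDeriv e y v) =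
      fderiv ℝ (fun y => f (e.symm y)) y (chartShape e S y v - a • v) := by
  rw [fderiv_comp_chart_symm he hy (mdifferentiableAt_of_chart he hf (e.map_target hy)),
    map_sub (chartSymmDeriv e y), map_smul (chartSymmDeriv e y), chartSymmDeriv_chartShape he hy]

section Family

variable {S : ShapeField M} {A B : M → ℝ}

/-- The chart expressions of the associated coframing of a surface. -/
lemma chart_adapted (hS : S.IsSmooth) (hAB : IsPrincipalCurvatures S A B)
    (hinv : IsInvertible A B) (hnd : IsNondegenerate S A B) (p : M)
    (he : e = chartAt Plane p) :
    IsAdapted e.target (chartCovector e (theta1 S A B)) (chartCovector e (theta2 S A B))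
        (fun y => A (e.symm y)) (fun y => B (e.symm y)) ∧
      ContDiffOn ℝ ∞ (chartCovector e (theta1 S A B)) e.target ∧
      ContDiffOn ℝ ∞ (chartCovector e (theta2 S A B)) e.target ∧
      (∀ y ∈ e.target, ∀ v, chartCovector e (theta1 S A B) y v = 0 →
        chartCovector e (theta2 S A B) y v = 0 → v = 0) ∧
      (∀ y ∈ e.target, ∀ v, chartCovector e (theta1 S A B) y (chartShape e S y v) =
        A (e.symm y) * chartCovector e (theta1 S A B) y v) ∧
      ∀ y ∈ e.target, ∀ v, chartCovector e (theta2 S A B) y (chartShape e S y v) =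
        B (e.symm y) * chartCovector e (theta2 S A B) y v := by
  have hat : e ∈ atlas Plane M := he ▸ chart_mem_atlas Plane p
  have hSs : ContDiffOn ℝ ∞ (chartShape e S) e.target := he ▸ contDiffOn_chartShape hS p
  have hA : ∀ y ∈ e.target, Module.End.HasEigenvalue (chartShape e S y).toLinearMap
      (A (e.symm y)) := fun y hy => hasEigenvalue_chartShape hat hy (hAB.eigen_A _)
  have hB : ∀ y ∈ e.target, Module.End.HasEigenvalue (chartShape e S y).toLinearMap
      (B (e.symm y)) := fun y hy => hasEigenvalue_chartShape hat hy (hAB.eigen_B _)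
  obtain ⟨hAs, hBs⟩ := contDiffOn_eigenvalues hSs (fun y _ => hAB.lt (e.symm y)) hA hB
  refine adapted_of_shape e.open_target hSs (fun y _ => hAB.lt (e.symm y)) hA hB
    (fun y _ => (hinv (e.symm y)).1) (fun y _ => (hinv (e.symm y)).2) (fun y hy => ?_)
    (fun y hy => ?_) (fun y hy v => ?_) (fun y hy v => ?_)
  -- If `dA ∘ (S - A)` vanished in the chart, then `d''A` would vanish at the point, because the
  -- chart differential is onto the tangent space.
  · by_contra! h
    refine (hnd (e.symm y)).1 (ContinuousLinearMap.ext fun v => ?_)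
    rw [dDoublePrime_apply, ← chartSymmDeriv_chartDeriv hat hy v,
      chart_differential_sub hat hy hAs, h, mul_zero]
    rfl
  · by_contra! h
    refine (hnd (e.symm y)).2 (ContinuousLinearMap.ext fun v => ?_)
    rw [dPrime_apply, ← chartSymmDeriv_chartDeriv hat hy v,
      chart_differential_sub hat hy hBs, h, mul_zero]
    rfl
  · change _ * dPrime S A B B (e.symm y) (chartSymmDeriv e y v) = _
    rw [dPrime_apply, chart_differential_sub hat hy hBs]
  · change _ * dDoublePrime S A B A (e.symm y) (chartSymmDeriv e y v) = _
    rw [dDoublePrime_apply, chart_differential_sub hat hy hAs]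

lemma chart_isCoframing (hS : S.IsSmooth) (hAB : IsPrincipalCurvatures S A B)
    (hinv : IsInvertible A B) (hnd : IsNondegenerate S A B) (p : M)
    (he : e = chartAt Plane p) {K₁ K₂ : M → ℝ}
    (h₁ : HasExtDeriv (theta1 S A B)
      (fun q v w => K₁ q * wedge (theta1 S A B) (theta2 S A B) q v w))
    (h₂ : HasExtDeriv (theta2 S A B)
      (fun q v w => K₂ q * wedge (theta2 S A B) (theta1 S A B) q v w)) :
    IsCoframing e.target (chartCovector e (theta1 S A B)) (chartCovector e (theta2 S A B))
      (fun y => K₁ (e.symm y)) (fun y => K₂ (e.symm y)) := by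
  have hat : e ∈ atlas Plane M := he ▸ chart_mem_atlas Plane p
  obtain ⟨-, hs₁, hs₂, hinj, -, -⟩ := chart_adapted hS hAB hinv hnd p he
  exact ⟨e.open_target, hs₁, hs₂, hinj,
    fun y hy => fderiv_chartCovector_sub h₁ hat hy
      ((hs₁.contDiffAt (e.open_target.mem_nhds hy)).differentiableAt (by simp)),
    fun y hy => fderiv_chartCovector_sub h₂ hat hy
      ((hs₂.contDiffAt (e.open_target.mem_nhds hy)).differentiableAt (by simp))⟩

lemma chart_hasFrameDeriv {p : M} (he : e = chartAt Plane p) {K a b : M → ℝ}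
    (hK : ContMDiff (𝓡 2) 𝓘(ℝ, ℝ) ∞ K) {θ₁ θ₂ : OneForm M}
    (hd : ∀ q, differential K q = a q • θ₁ q + b q • θ₂ q) {y : Plane} (hy : y ∈ e.target) :
    HasFrameDeriv (chartCovector e θ₁ y) (chartCovector e θ₂ y) (fun y => K (e.symm y))
      (a (e.symm y)) (b (e.symm y)) y := by
  have hat : e ∈ atlas Plane M := he ▸ chart_mem_atlas Plane p
  have hKs : ContDiffOn ℝ ∞ (fun y => K (e.symm y)) e.target :=
    he ▸ contDiffOn_comp_chart_symm hK p
  refine HasFDerivAt.congr_fderiv ((hKs.contDiffAt (e.open_target.mem_nhds hy)).differentiableAt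
    (by simp)).hasFDerivAt (ContinuousLinearMap.ext fun v => ?_)
  rw [fderiv_comp_chart_symm hat hy (mdifferentiableAt_of_chart hat hKs (e.map_target hy)), hd]
  rfl

lemma diffMap_comp_chart (hat : e ∈ atlas Plane M) {f : Plane → Space} {y : Plane}
    (hy : y ∈ e.target) {f' : Plane →L[ℝ] Space} (hf : HasFDerivAt f f' y)
    (v : TangentSpace (𝓡 2) (e.symm y)) :
    diffMap (fun q => f (e q)) (e.symm y) v = f' (chartDeriv e (e.symm y) v) := by
  have h1 : MDifferentiableAt (𝓡 2) (𝓡 2) e (e.symm y) :=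
    mdifferentiableAt_atlas hat (e.map_target hy)
  rw [← e.right_inv hy] at hf
  have h2 := hf.hasMFDerivAt.comp (e.symm y) h1.hasMFDerivAt
  exact congrArg (fun L : TangentSpace (𝓡 2) (e.symm y) →L[ℝ] Space => L v) h2.mfderiv

/-- The neighborhood is the chart preimage of the disk given by `exists_plane_family`. Composition
with the chart preserves the fundamental forms and the congruence relation. -/
theorem exists_surface_family (hS : S.IsSmooth) (hAB : IsPrincipalCurvatures S A B)
    (hinv : IsInvertible A B) (hnd : IsNondegenerate S A B) (p : M)
    (he : e = chartAt Plane p) {K₁ K₂ : Plane → ℝ}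
    (hθ : IsCoframing e.target (chartCovector e (theta1 S A B))
      (chartCovector e (theta2 S A B)) K₁ K₂)
    {t₀ : Param} {r : ℝ} (hr : 0 < r) (hU : ball (e p) r ⊆ e.target)
    {u v w w' : Param × Plane → ℝ} (huv : IsPotentialFamily (chartCovector e (theta1 S A B))
      (chartCovector e (theta2 S A B)) K₁ K₂ (e p) t₀ r u v w w') :
    ∃ N : Set M, IsOpen N ∧ IsConnected N ∧ p ∈ N ∧
      ∃ P : Set Param, IsOpen P ∧ IsConnected P ∧
        ∃ X : Param → M → Space,
          ContMDiffOn ((𝓡 3).prod (𝓡 2)) 𝓘(ℝ, Space) ∞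
            (fun z : Param × M => X z.1 z.2) (P ×ˢ N) ∧
          (∀ t ∈ P, Realizes S N (X t)) ∧
          ∀ s ∈ P, ∀ t ∈ P, s ≠ t → ¬ CongruentOn N (X s) (X t) := by
  have hat : e ∈ atlas Plane M := he ▸ chart_mem_atlas Plane p
  have hp : p ∈ e.source := he ▸ mem_chart_source Plane p
  obtain ⟨hA, -, -, -, hS₁, hS₂⟩ := chart_adapted hS hAB hinv hnd p he
  obtain ⟨ε, hε, hεU, X, n, hX, hn, hreal, hcong⟩ := exists_plane_family hθ hA hS₁ hS₂ hr hU huv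
  set N : Set M := e.symm '' ball (e p) ε with hN
  have hNs : N ⊆ e.source := by
    rintro _ ⟨y, hy, rfl⟩
    exact e.map_target (hεU hy)
  have hNb : MapsTo e N (ball (e p) ε) := by
    rintro _ ⟨y, hy, rfl⟩
    rwa [e.right_inv (hεU hy)]
  have hchart : ContMDiffOn (𝓡 2) 𝓘(ℝ, Plane) ∞ e N :=
    (he ▸ contMDiffOn_chart : ContMDiffOn (𝓡 2) (𝓡 2) ∞ e e.source).mono hNs
  have hslice : ∀ f : Param × Plane → Space, ContDiffOn ℝ ∞ f (ball t₀ ε ×ˢ ball (e p) ε) →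
      ∀ t ∈ ball t₀ ε, ContMDiffOn (𝓡 2) 𝓘(ℝ, Space) ∞ (fun q => f (t, e q)) N := by
    intro f hf t ht
    have h1 : ContDiffOn ℝ ∞ (fun y => f (t, y)) (ball (e p) ε) :=
      hf.comp (contDiffOn_const.prodMk contDiffOn_id) fun y hy => ⟨ht, hy⟩
    exact h1.contMDiffOn.comp hchart hNb
  refine ⟨N, ?_, ?_, ?_, ball t₀ ε, isOpen_ball,
    (convex_ball t₀ ε).isConnected ⟨t₀, mem_ball_self hε⟩, fun t q => X (t, e q), ?_,
    fun t ht => ⟨hslice X hX t ht, ?_, fun q => n (t, e q), hslice n hn t ht, ?_, ?_, ?_⟩, ?_⟩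
  · exact e.symm.isOpen_image_of_subset_source isOpen_ball hεU
  · exact ((convex_ball (e p) ε).isConnected ⟨e p, mem_ball_self hε⟩).image _
      (e.continuousOn_symm.mono hεU)
  · exact ⟨e p, mem_ball_self hε, e.left_inv hp⟩
  · have h1 : ContMDiffOn ((𝓡 3).prod (𝓡 2)) 𝓘(ℝ, Param × Plane) ∞
        (fun z : Param × M => (z.1, e z.2)) (ball t₀ ε ×ˢ N) :=
      contMDiffOn_fst.prodMk_space (hchart.comp contMDiffOn_snd fun z hz => hz.2)
    exact hX.contMDiffOn.comp h1 fun z hz => ⟨hz.1, hNb hz.2⟩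
  · rintro _ ⟨y, hy, rfl⟩ a b hab
    obtain ⟨X', n', hX', hn', hinj, -⟩ := hreal t ht y hy
    rw [diffMap_comp_chart hat (hεU hy) hX', diffMap_comp_chart hat (hεU hy) hX'] at hab
    rw [← chartSymmDeriv_chartDeriv hat (hεU hy) a, hinj hab,
      chartSymmDeriv_chartDeriv hat (hεU hy)]
  · intro q hq
    obtain ⟨X', n', -, -, -, h, -⟩ := hreal t ht (e q) (hNb hq)
    exact h
  · rintro _ ⟨y, hy, rfl⟩ a
    obtain ⟨X', n', hX', hn', -, -, h, -⟩ := hreal t ht y hy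
    rw [diffMap_comp_chart hat (hεU hy) hX']
    beta_reduce
    rw [e.right_inv (hεU hy)]
    exact h _
  · rintro _ ⟨y, hy, rfl⟩ a b
    obtain ⟨X', n', hX', hn', -, -, -, h⟩ := hreal t ht y hy
    have hSc : ∀ c, chartDeriv e (e.symm y) (S (e.symm y) c) =
        chartShape e S y (chartDeriv e (e.symm y) c) := fun c => by
      change _ = chartDeriv e (e.symm y) (S (e.symm y) (chartSymmDeriv e y _))
      rw [chartSymmDeriv_chartDeriv hat (hεU hy)]
    simp only [secondForm, firstForm, diffMap_comp_chart hat (hεU hy) hX',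
      diffMap_comp_chart hat (hεU hy) hn', hSc]
    exact h _ _
  · rintro s hs t ht hst ⟨F, hF⟩
    refine hcong s hs t ht hst ⟨F, fun y hy => ?_⟩
    have h := hF (e.symm y) ⟨y, hy, rfl⟩
    simpa only [e.right_inv (hεU hy)] using h

end Family

end SurfaceTransfer

theorem mainTheorem4 {M : Type*} [TopologicalSpace M] [ChartedSpace Plane M]
    [IsManifold (𝓡 2) ∞ M] (S : ShapeField M) (hS : S.IsSmooth) (A B : M → ℝ)
    (hAB : IsPrincipalCurvatures S A B) (hinv : IsInvertible A B)
    (hnd : IsNondegenerate S A B)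
    (hθ : TypeISystem (theta1 S A B) (theta2 S A B) ∨
      DualTypeISystem (theta1 S A B) (theta2 S A B) ∨
      TypeIISystem (theta1 S A B) (theta2 S A B)) (p : M) :
    ∃ N : Set M, IsOpen N ∧ IsConnected N ∧ p ∈ N ∧
      ∃ P : Set (EuclideanSpace ℝ (Fin 3)), IsOpen P ∧ IsConnected P ∧
        ∃ X : EuclideanSpace ℝ (Fin 3) → M → Space,
          ContMDiffOn ((𝓡 3).prod (𝓡 2)) 𝓘(ℝ, Space) ∞
            (fun z : EuclideanSpace ℝ (Fin 3) × M => X z.1 z.2) (P ×ˢ N) ∧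
          (∀ t ∈ P, Realizes S N (X t)) ∧
          ∀ s ∈ P, ∀ t ∈ P, s ≠ t → ¬ CongruentOn N (X s) (X t) := by
  set e := chartAt Plane p with he
  have hp : e p ∈ e.target := e.map_source (mem_chart_source Plane p)
  rcases hθ with ⟨K, K', hK, h₁, h₂, hd⟩ | ⟨K, K', hK, h₁, h₂, hd⟩ | ⟨h₁, h₂⟩
  · have hc := chart_isCoframing (K₁ := fun _ => 1) hS hAB hinv hnd p he
      (by simpa only [one_mul] using h₁) h₂
    obtain ⟨r, hr, hU, u, v, w, w', -, huv⟩ := exists_potentialFamily_typeI hc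
      (contDiffOn_comp_chart_symm hK p) (fun y hy => chart_hasFrameDeriv he hK hd hy) hp
    exact exists_surface_family hS hAB hinv hnd p he hc hr hU huv
  · have hc := chart_isCoframing (K₂ := fun _ => 1) hS hAB hinv hnd p he h₁
      (by simpa only [one_mul] using h₂)
    -- Exchanging `θ₁` and `θ₂` turns the dual system into Type I. Only the potentials are built in
    -- the exchanged frame; they are swapped back before the immersions are constructed.
    obtain ⟨r, hr, hU, u, v, w, w', hg, huv⟩ := exists_potentialFamily_typeI hc.swap
      (contDiffOn_comp_chart_symm hK p)
      (fun y hy => (chart_hasFrameDeriv he hK hd hy).swap) hp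
    exact exists_surface_family hS hAB hinv hnd p he hc hr hU (huv.swap fun t => hg (t, e p))
  · have hc := chart_isCoframing hS hAB hinv hnd p he h₁ h₂
    obtain ⟨r, hr, hU, u, v, w, w', -, huv⟩ := exists_potentialFamily_typeII hc hp
    exact exists_surface_family hS hAB hinv hnd p he hc hr hU huv
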